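/- For a nonnegative integer $s$ let $$\psi_s(\tau)=\sum_{n=1}^{\infty}\frac{\sec(\pi n\tau)}{n^s}$$ be the secant Dirichlet series, and write $D=\mathrm{d}/\mathrm{d}\tau$. At a real irrational point $\rho$ the value of the $j$th derivative is that of the series differentiated term by term, $$(D^j\psi_s)(\rho)=\sum_{n=1}^{\infty}\frac{1}{n^s}\,\frac{\mathrm{d}^j}{\mathrm{d}\tau^j}\sec(\pi n\tau)\Big|_{\tau=\rho}.$$ Let $\rho$ be a real quadratic irrationality, that is, an irrational real root of a quadratic polynomial with integer coefficients. Let $j,s$ be nonnegative integers with $s$ even and $s\ge 2j+2$. Then the series for $(D^j\psi_s)(\rho)$ converges absolutely, and $$(D^j\psi_s)(\rho)\in\pi^s\,\mathbb{Q}(\rho).$$ If, in addition, $\rho^2\in\mathbb{Q}$ and $j$ is even (so that $j$ and $s$ have the same parity), then $$(D^j\psi_s)(\rho)\in(\pi\rho)^s\,\mathbb{Q}.$$ -/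

import Mathlib

/-- A real quadratic irrationality: an irrational real root of a quadratic polynomial with
integer coefficients. -/
def IsRealQuadraticIrrationality (ρ : ℝ) : Prop :=
  Irrational ρ ∧ ∃ a b c : ℤ, a ≠ 0 ∧ (a : ℝ) * ρ ^ 2 + (b : ℝ) * ρ + (c : ℝ) = 0

/-- The `n`-th term `sec (π n τ) / n ^ s` of the secant Dirichlet series, as a function of `τ`. -/
noncomputable def secantTerm (s n : ℕ) (τ : ℝ) : ℝ :=
  (Real.cos (Real.pi * n * τ))⁻¹ / (n : ℝ) ^ s

/-- The secant Dirichlet series `ψ_s (τ) = ∑_{n ≥ 1} sec (π n τ) / n ^ s`. -/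
noncomputable def secantDirichlet (s : ℕ) (τ : ℝ) : ℝ :=
  ∑' n : ℕ, secantTerm s (n + 1) τ

/-- The `n`-th term `D ^ j [sec (π n τ) / n ^ s]`, with `D = d / dτ`, of the `j`-th derivative of
the secant Dirichlet series. -/
noncomputable def secantTermD (j s n : ℕ) (τ : ℝ) : ℝ :=
  iteratedDeriv j (secantTerm s n) τ

/-- `(D ^ j ψ_s) (τ)` for real `τ`: the series `ψ_s` differentiated `j` times term by term. (At
real points no other derivative is available: `ψ_s` has a pole in some term at every rational
number with even denominator, so it is not defined on any interval.) -/
noncomputable def secantDirichletD (j s : ℕ) (τ : ℝ) : ℝ :=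
  ∑' n : ℕ, secantTermD j s (n + 1) τ

theorem secantDirichletD_zero (s : ℕ) (τ : ℝ) :
    secantDirichletD 0 s τ = secantDirichlet s τ := by
  simp [secantDirichletD, secantDirichlet, secantTermD]

open Filter Topology Asymptotics Finset

/-! On the upper half plane the series `complexSecantDirichlet` is, after adding a rational multiple
of `π ^ s * τ ^ s`, an Eichler-type integral of weight `1 - s` for the level 2 group generated, up
to sign, by `τ ↦ τ + 2` and `τ ↦ τ / (2 * τ + 1)`: its defects are `π ^ s` times rational
polynomials (`exists_hasRationalPeriod`). Translation is immediate. For the second generator, the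
secant is expanded in partial fractions and the double series is summed in the other order; what is
not polynomial is a cotangent sum visibly invariant under that generator.

A solution of Pell's equation gives a matrix of this group fixing `ρ`. Its functional equation
relates the function near `ρ` to itself. Although `ρ` lies on the boundary, the function has a
nontangential Taylor expansion there up to order `j`, whose coefficients come from the termwise
derivatives (`tendsto_complexSecantDirichlet_sub`). This rests on the bad approximability of `ρ`:
small values of `cos (π n ρ)` are rare enough for dominated convergence
(`summable_inv_sq_mul_abs_cos`).

Comparing expansions on both sides (`sum_mul_coeff_eq`) gives a triangular linear system over `ℚ(ρ)`
with right-hand side in `π ^ s * ℚ(ρ)`. With `ε = c * ρ + d`, its diagonal entries are `ε ^ (s - 2 *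
k) - σ * ε`, nonzero because `ε` is irrational and so different from `±1`. The solution is found in
the abstract field before a real embedding is chosen, so it serves the conjugate of `ρ` too. If `ρ ^
2` is rational the conjugate is `-ρ`; evenness of the series and of `j` makes the coefficient
invariant under conjugation, hence rational. -/

/-! ### Diophantine approximation and absolute convergence -/

/-- Liouville's inequality in degree 2 keeps `q * ρ` at distance at least `1 / (A * q)` from the
integers, and Jordan's inequality turns this distance into a sine. -/
theorem IsRealQuadraticIrrationality.exists_div_le_abs_sin {ρ : ℝ}
    (hρ : IsRealQuadraticIrrationality ρ) :
    ∃ c : ℝ, 0 < c ∧ ∀ q : ℕ, 0 < q → c / q ≤ |Real.sin (Real.pi * q * ρ)| := by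
  obtain ⟨hirr, a, b, c, ha, h⟩ := hρ
  let f : Polynomial ℤ := Polynomial.C a * Polynomial.X ^ 2 + Polynomial.C b * Polynomial.X
    + Polynomial.C c
  have hdeg : f.natDegree = 2 := Polynomial.natDegree_quadratic ha
  have hf : f ≠ 0 := fun h0 => by simp [h0] at hdeg
  obtain ⟨A, hA, hL⟩ := Liouville.exists_pos_real_of_irrational_root hirr hf
    (by simpa [f] using h)
  refine ⟨2 / A, by positivity, fun q hq => ?_⟩
  obtain ⟨m, rfl⟩ : ∃ m, q = m + 1 := ⟨q - 1, by omega⟩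
  set x : ℝ := (m + 1 : ℕ) * ρ - round ((m + 1 : ℕ) * ρ) with hx
  have hx2 : |x| ≤ 1 / 2 := abs_sub_round _
  have hsin : |Real.sin (Real.pi * (m + 1 : ℕ) * ρ)| = |Real.sin (Real.pi * x)| := by
    have : Real.pi * x = Real.pi * (m + 1 : ℕ) * ρ - (round ((m + 1 : ℕ) * ρ) : ℤ) * Real.pi := by
      rw [hx]; ring
    rw [this, Real.sin_sub_int_mul_pi, abs_mul]
    simp
  have h1 : 2 * |x| ≤ |Real.sin (Real.pi * x)| := by
    have h2 := Real.mul_le_sin (x := Real.pi * |x|) (by positivity)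
      (by nlinarith [Real.pi_pos])
    have h3 : 2 / Real.pi * (Real.pi * |x|) = 2 * |x| := by field_simp
    rw [h3] at h2
    rcases abs_choice x with h4 | h4
    · rw [h4] at h2 ⊢; exact h2.trans (le_abs_self _)
    · rw [h4] at h2 ⊢
      rw [mul_neg Real.pi, Real.sin_neg] at h2
      exact h2.trans (neg_le_abs _)
  have h5 := hL (round ((m + 1 : ℕ) * ρ)) m
  rw [hdeg] at h5
  have h6 : |ρ - (round ((m + 1 : ℕ) * ρ) : ℤ) / ((m : ℝ) + 1)| = |x| / (m + 1) := by
    have : ρ - (round ((m + 1 : ℕ) * ρ) : ℤ) / ((m : ℝ) + 1) = x / (m + 1) := by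
      rw [hx]; push_cast; field_simp
    rw [this, abs_div, abs_of_pos (by positivity : (0 : ℝ) < m + 1)]
  rw [h6] at h5
  have h7 : 1 ≤ ((m : ℝ) + 1) * |x| * A := by
    calc (1 : ℝ) ≤ _ := h5
      _ = _ := by field_simp
  rw [hsin]
  refine le_trans ?_ h1
  push_cast
  rw [div_div, div_le_iff₀ (by positivity)]
  nlinarith

theorem cos_pi_mul_ne_zero {ρ : ℝ} (hρ : Irrational ρ) {n : ℕ} (hn : 0 < n) :
    Real.cos (Real.pi * n * ρ) ≠ 0 := by
  intro h
  obtain ⟨k, hk⟩ := Real.cos_eq_zero_iff.mp h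
  apply hρ
  refine ⟨(2 * k + 1) / (2 * n), ?_⟩
  have hn' : (n : ℝ) ≠ 0 := by positivity
  have : Real.pi * (n * ρ) = Real.pi * ((2 * k + 1) / 2) := by linarith
  have := mul_left_cancel₀ Real.pi_ne_zero this
  push_cast
  field_simp
  linarith

/-- The duplication formula at `2 * n`: `|sin 2θ| ≤ 2 * |cos θ|`. -/
theorem div_le_abs_cos {ρ c : ℝ}
    (h : ∀ q : ℕ, 0 < q → c / q ≤ |Real.sin (Real.pi * q * ρ)|) {n : ℕ} (hn : 0 < n) :
    c / 4 / n ≤ |Real.cos (Real.pi * n * ρ)| := by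
  have h1 := h (2 * n) (by omega)
  have h2 : Real.sin (Real.pi * (2 * n : ℕ) * ρ)
      = 2 * Real.sin (Real.pi * n * ρ) * Real.cos (Real.pi * n * ρ) := by
    rw [← Real.sin_two_mul]; push_cast; ring_nf
  rw [h2, abs_mul, abs_mul, abs_two] at h1
  have h3 := Real.abs_sin_le_one (Real.pi * n * ρ)
  have h4 := abs_nonneg (Real.cos (Real.pi * n * ρ))
  have h5 : c / (2 * n : ℕ) = 2 * (c / 4 / n) := by push_cast; field_simp; ring
  rw [h5] at h1
  nlinarith

theorem abs_sin_sub_le (x y : ℝ) : |Real.sin (x - y)| ≤ |Real.cos x| + |Real.cos y| := by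
  have h1 := Real.abs_sin_le_one x
  have h2 := Real.abs_sin_le_one y
  have h3 := abs_sub (Real.sin x * Real.cos y) (Real.cos x * Real.sin y)
  rw [abs_mul, abs_mul] at h3
  rw [Real.sin_sub]
  nlinarith [abs_nonneg (Real.cos x), abs_nonneg (Real.cos y)]

/-- The pointwise bound on the cosine only compares the terms with `1 / n`. The gain comes from
repulsion: two indices whose cosines are both about `2 ^ (-k)` differ by at least a constant times
`2 ^ k`, since otherwise the sine at their difference would be too small. So each dyadic class
contributes at most a constant times `2 ^ (-k) * ∑ 1 / i ^ 2`. -/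
theorem summable_inv_sq_mul_abs_cos {ρ c : ℝ} (hρ : Irrational ρ) (hc : 0 < c)
    (h : ∀ q : ℕ, 0 < q → c / q ≤ |Real.sin (Real.pi * q * ρ)|) :
    Summable fun n : ℕ =>
      (((n + 1 : ℕ) : ℝ) ^ 2 * |Real.cos (Real.pi * (n + 1 : ℕ) * ρ)|)⁻¹ := by
  set δ : ℕ → ℝ := fun n => |Real.cos (Real.pi * (n + 1 : ℕ) * ρ)| with hδ
  have hδpos (n) : 0 < δ n := abs_pos.mpr (cos_pi_mul_ne_zero hρ n.succ_pos)
  have hδle (n) : δ n ≤ 1 := Real.abs_cos_le_one _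
  have hex (n) : ∃ k : ℕ, (1 / 2 : ℝ) ^ (k + 1) < δ n ∧ δ n ≤ (1 / 2) ^ k :=
    exists_nat_pow_near_of_lt_one (hδpos n) (hδle n) (by norm_num) (by norm_num)
  choose k hk1 hk2 using hex
  have hlow (n) : c / 4 * 2 ^ k n ≤ (n + 1 : ℕ) := by
    have h1 := (div_le_abs_cos h n.succ_pos).trans (hk2 n)
    rw [one_div, inv_pow, div_le_iff₀ (by positivity), inv_mul_eq_div,
      le_div_iff₀ (by positivity)] at h1
    exact h1
  have hsep (m n : ℕ) (hmn : m < n) (hk : k m = k n) : c / 2 * 2 ^ k n ≤ (n : ℝ) - m := by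
    have h1 := h (n - m) (by omega)
    have h2 : Real.pi * (n - m : ℕ) * ρ
        = Real.pi * (n + 1 : ℕ) * ρ - Real.pi * (m + 1 : ℕ) * ρ := by
      rw [Nat.cast_sub hmn.le]; push_cast; ring
    have h3 : |Real.sin (Real.pi * (n - m : ℕ) * ρ)| ≤ δ n + δ m := by
      rw [h2]
      exact abs_sin_sub_le _ _
    have h4 : c / (n - m : ℕ) ≤ 2 * (1 / 2) ^ k n := by
      have := hk2 m
      rw [hk] at this
      linarith [hk2 n]
    have hpos : (0 : ℝ) < (n - m : ℕ) := by exact_mod_cast (by omega : 0 < n - m)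
    rw [one_div, inv_pow, ← div_eq_mul_inv, div_le_div_iff₀ hpos (by positivity),
      Nat.cast_sub hmn.le] at h4
    linarith
  -- Bins of width `c / 4 * 2 ^ k`, half the separation in `hsep`, hold at most one index of class
  -- `k`; by `hlow` the bin numbered 0 is empty.
  let i : ℕ → ℕ := fun n => ⌊((n + 1 : ℕ) : ℝ) / (c / 4 * 2 ^ k n)⌋₊
  have hipos (n) : 1 ≤ i n := by
    apply Nat.le_floor
    rw [Nat.cast_one, le_div_iff₀ (by positivity), one_mul]
    exact hlow n
  have hile (n) : (i n : ℝ) * (c / 4 * 2 ^ k n) ≤ (n + 1 : ℕ) := by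
    rw [← le_div_iff₀ (by positivity)]
    exact Nat.floor_le (by positivity)
  have hilt (n) : ((n + 1 : ℕ) : ℝ) < (i n + 1) * (c / 4 * 2 ^ k n) := by
    rw [← div_lt_iff₀ (by positivity)]
    exact Nat.lt_floor_add_one _
  have hne (m n : ℕ) (hmn : m < n) : ¬ (k m = k n ∧ i m = i n) := by
    rintro ⟨h1, h2⟩
    have h3 := hsep m n hmn h1
    have h4 := hile m
    have h5 := hilt n
    rw [h1, h2] at h4
    push_cast at h4 h5
    nlinarith [(by positivity : 0 < c * 2 ^ k n)]
  have hinj : Function.Injective fun n => (k n, i n) := by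
    intro m n hmn
    simp only [Prod.mk.injEq] at hmn
    rcases lt_trichotomy m n with hlt | heq | hlt
    · exact absurd hmn (hne m n hlt)
    · exact heq
    · exact absurd ⟨hmn.1.symm, hmn.2.symm⟩ (hne n m hlt)
  have hsum := Summable.mul_of_nonneg (f := fun l : ℕ => (1 / 2 : ℝ) ^ l)
    (g := fun l : ℕ => 1 / (l : ℝ) ^ 2) summable_geometric_two
    (Real.summable_one_div_nat_pow.mpr one_lt_two)
    (fun l => pow_nonneg one_half_pos.le l) (fun l => one_div_nonneg.mpr (sq_nonneg (l : ℝ)))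
  clear_value i
  have hsum2 := hsum.comp_injective hinj
  simp only [Function.comp_def] at hsum2
  have hle (n) : (((n + 1 : ℕ) : ℝ) ^ 2 * δ n)⁻¹
      ≤ 2 * (4 / c) ^ 2 * ((1 / 2 : ℝ) ^ k n * (1 / (i n : ℝ) ^ 2)) := by
    have hi' : (0 : ℝ) < i n := by exact_mod_cast hipos n
    have h1 : ((i n : ℝ) * (c / 4 * 2 ^ k n)) ^ 2 * (1 / 2) ^ (k n + 1)
        ≤ ((n + 1 : ℕ) : ℝ) ^ 2 * δ n :=
      mul_le_mul (pow_le_pow_left₀ (by positivity) (hile n) 2) (hk1 n).le (by positivity)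
        (by positivity)
    calc _ ≤ (((i n : ℝ) * (c / 4 * 2 ^ k n)) ^ 2 * (1 / 2) ^ (k n + 1))⁻¹ :=
          inv_anti₀ (by positivity) h1
      _ = 2 * (4 / c) ^ 2 * ((1 / 2 : ℝ) ^ k n * (1 / (i n : ℝ) ^ 2)) := by
          rw [one_div_pow, one_div_pow]
          field_simp
          ring
  have hnn (n) : 0 ≤ (((n + 1 : ℕ) : ℝ) ^ 2 * δ n)⁻¹ :=
    inv_nonneg.mpr (mul_nonneg (sq_nonneg _) (hδpos n).le)
  exact Summable.of_nonneg_of_le hnn hle (hsum2.mul_left (2 * (4 / c) ^ 2))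

theorem IsRealQuadraticIrrationality.summable_pow_div_pow_mul_abs_cos_pow {ρ : ℝ}
    (hρ : IsRealQuadraticIrrationality ρ) {j s : ℕ} (hjs : 2 * j + 2 ≤ s) :
    Summable fun n : ℕ => ((n + 1 : ℕ) : ℝ) ^ j / (((n + 1 : ℕ) : ℝ) ^ s *
      |Real.cos (Real.pi * (n + 1 : ℕ) * ρ)| ^ (j + 1)) := by
  obtain ⟨c, hc, h⟩ := hρ.exists_div_le_abs_sin
  refine Summable.of_nonneg_of_le (fun n => by positivity) (fun n => ?_)
    ((summable_inv_sq_mul_abs_cos hρ.1 hc h).mul_left ((4 / c) ^ j))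
  set N : ℝ := ((n + 1 : ℕ) : ℝ) with hN
  have hN1 : 1 ≤ N := by rw [hN]; push_cast; linarith [(Nat.cast_nonneg n : (0 : ℝ) ≤ n)]
  set δ := |Real.cos (Real.pi * N * ρ)| with hδ
  have hδpos : 0 < δ := abs_pos.mpr (cos_pi_mul_ne_zero hρ.1 n.succ_pos)
  have h1 : c / 4 / N ≤ δ := div_le_abs_cos h n.succ_pos
  -- Only `j` of the `j + 1` cosines are bounded pointwise, at the cost of `N ^ j`; the last is kept
  -- for the averaged estimate.
  have h2 : N ^ (2 * j + 2) * ((c / 4 / N) ^ j * δ) ≤ N ^ s * δ ^ (j + 1) := by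
    rw [pow_succ δ]
    gcongr
  calc N ^ j / (N ^ s * δ ^ (j + 1)) ≤ N ^ j / (N ^ (2 * j + 2) * ((c / 4 / N) ^ j * δ)) := by
        gcongr
    _ = (4 / c) ^ j * (N ^ 2 * δ)⁻¹ := by
        rw [div_pow, div_pow, div_pow, pow_add, pow_mul']
        field_simp

/-! ### Lower bounds for the complex cosine -/

theorem norm_cos_add_sub_cos_le (x : ℝ) {u : ℂ} (hu : ‖u‖ ≤ 1 / 4) :
    ‖Complex.cos (x + u) - Complex.cos x‖ ≤ 2 * ‖u‖ := by
  have key (y : ℝ) (v : ℂ) (hv : ‖v‖ = ‖u‖) :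
      ‖Complex.exp (y * Complex.I) * (Complex.exp v - 1)‖ ≤ 2 * ‖u‖ := by
    rw [norm_mul, Complex.norm_exp_ofReal_mul_I, one_mul, ← hv]
    exact Complex.norm_exp_sub_one_le (by linarith)
  have h1 : Complex.cos (x + u) - Complex.cos x
      = (Complex.exp (x * Complex.I) * (Complex.exp (u * Complex.I) - 1)
        + Complex.exp ((-x : ℝ) * Complex.I) * (Complex.exp (-(u * Complex.I)) - 1)) / 2 := by
    rw [Complex.cos, Complex.cos, mul_sub, mul_sub, ← Complex.exp_add, ← Complex.exp_add]
    push_cast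
    ring_nf
  rw [h1, norm_div, RCLike.norm_ofNat, div_le_iff₀ two_pos]
  refine (norm_add_le _ _).trans ?_
  linarith [key x (u * Complex.I) (by simp), key (-x) (-(u * Complex.I)) (by simp)]

theorem norm_cos_ge_of_le {x : ℝ} {z : ℂ} (hz : ‖z - x‖ ≤ |Real.cos x| / 4) :
    |Real.cos x| / 2 ≤ ‖Complex.cos z‖ := by
  have h1 := norm_cos_add_sub_cos_le x (u := z - x)
    (hz.trans (by linarith [Real.abs_cos_le_one x]))
  rw [add_sub_cancel] at h1
  have h2 := norm_sub_norm_le (Complex.cos x) (Complex.cos z)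
  rw [norm_sub_rev, ← Complex.ofReal_cos, Complex.norm_real, Real.norm_eq_abs] at h2
  rw [← Complex.ofReal_cos] at h1
  linarith

/-- The two exponentials in the cosine have moduli `exp (±Im z)`, so the modulus of the cosine is at
least `|sinh (Im z)|`. -/
theorem abs_im_le_norm_cos (z : ℂ) : |z.im| ≤ ‖Complex.cos z‖ := by
  have h1 : |‖Complex.exp (-z * Complex.I)‖ - ‖Complex.exp (z * Complex.I)‖|
      ≤ 2 * ‖Complex.cos z‖ := by
    have h2 : (2 : ℝ) * ‖Complex.cos z‖
        = ‖Complex.exp (-z * Complex.I) - -Complex.exp (z * Complex.I)‖ := by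
      rw [sub_neg_eq_add, add_comm, ← Complex.two_cos, norm_mul, RCLike.norm_ofNat]
    rw [h2, ← norm_neg (Complex.exp (z * Complex.I))]
    exact abs_norm_sub_norm_le _ _
  have h3 : ‖Complex.exp (-z * Complex.I)‖ - ‖Complex.exp (z * Complex.I)‖
      = 2 * Real.sinh z.im := by
    rw [Complex.norm_exp, Complex.norm_exp, Real.sinh_eq]
    simp
    ring
  rw [h3, abs_mul, abs_two, Real.abs_sinh] at h1
  linarith [Real.self_le_sinh_iff.mpr (abs_nonneg z.im)]

/-- Close to `x` the cosine has barely moved; farther away in the cone the imaginary part is itself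
at least `|cos x| / 8`. -/
theorem norm_cos_ge_of_norm_sub_le_im {x : ℝ} {z : ℂ} (hz : ‖z - x‖ ≤ 2 * z.im) :
    |Real.cos x| / 8 ≤ ‖Complex.cos z‖ := by
  rcases le_total ‖z - x‖ (|Real.cos x| / 4) with h | h
  · linarith [norm_cos_ge_of_le h, abs_nonneg (Real.cos x)]
  · linarith [abs_im_le_norm_cos z, le_abs_self z.im]

/-! ### Taylor remainders, uniformly in a cone -/

/-- The `i`-th Taylor coefficient of `f` at `x`. -/
noncomputable def taylorCoeffAt (f : ℂ → ℂ) (x : ℂ) (i : ℕ) : ℂ :=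
  (i.factorial : ℂ)⁻¹ * iteratedDeriv i f x

theorem norm_taylorCoeffAt_le {f : ℂ → ℂ} {x : ℂ} {r M : ℝ} (hr : 0 < r)
    (hf : ∀ z ∈ Metric.closedBall x r, DifferentiableAt ℂ f z)
    (hM : ∀ z ∈ Metric.closedBall x r, ‖f z‖ ≤ M) (i : ℕ) :
    ‖taylorCoeffAt f x i‖ ≤ M / r ^ i := by
  have hd : DiffContOnCl ℂ f (Metric.ball x r) := by
    apply DifferentiableOn.diffContOnCl
    intro z hz
    exact (hf z (Metric.closure_ball_subset_closedBall hz)).differentiableWithinAt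
  have := Complex.norm_iteratedDeriv_le_of_forall_mem_sphere_norm_le i hr hd
    (fun z hz => hM z (Metric.sphere_subset_closedBall hz))
  rw [taylorCoeffAt, norm_mul, norm_inv, Complex.norm_natCast, inv_mul_le_iff₀ (by positivity)]
  rw [mul_div_assoc] at this
  exact this

theorem norm_sub_taylor_le_of_lt {f : ℂ → ℂ} {x : ℂ} {r M : ℝ} (hr : 0 < r)
    (hf : ∀ z ∈ Metric.closedBall x r, DifferentiableAt ℂ f z)
    (hM : ∀ z ∈ Metric.closedBall x r, ‖f z‖ ≤ M) (j : ℕ) {z : ℂ} (hz : ‖z - x‖ ≤ r / 2) :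
    ‖f z - ∑ i ∈ range (j + 1), taylorCoeffAt f x i * (z - x) ^ i‖
      ≤ 2 * M * (‖z - x‖ / r) ^ (j + 1) := by
  have hs : HasSum (fun i => taylorCoeffAt f x i * (z - x) ^ i) (f z) := by
    have := Complex.hasSum_taylorSeries_on_ball (f := f) (c := x) (r := r)
      (fun w hw => (hf w (Metric.ball_subset_closedBall hw)).differentiableWithinAt)
      (z := z) (by rw [Metric.mem_ball, dist_eq_norm]; linarith)
    have he : (fun i => taylorCoeffAt f x i * (z - x) ^ i)
        = fun i => ((i.factorial : ℂ))⁻¹ • (z - x) ^ i • iteratedDeriv i f x := by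
      ext i
      simp only [taylorCoeffAt, smul_eq_mul]
      ring
    rwa [he]
  have hs' := (hasSum_nat_add_iff' (j + 1)).mpr hs
  have hq0 : 0 ≤ ‖z - x‖ / r := by positivity
  have hq : ‖z - x‖ / r ≤ 1 / 2 := by rw [div_le_iff₀ hr]; linarith
  have hM0 : 0 ≤ M := (norm_nonneg _).trans (hM x (by simp [hr.le]))
  have hb : HasSum (fun i : ℕ => M * (‖z - x‖ / r) ^ (j + 1) * (1 / 2) ^ i)
      (M * (‖z - x‖ / r) ^ (j + 1) * 2) := hasSum_geometric_two.mul_left _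
  have := hs'.norm_le_of_bounded hb (fun i => ?_)
  · linarith
  · rw [norm_mul, norm_pow]
    calc _ ≤ M / r ^ (i + (j + 1)) * ‖z - x‖ ^ (i + (j + 1)) := by
          gcongr
          exact norm_taylorCoeffAt_le hr hf hM _
      _ = M * (‖z - x‖ / r) ^ (j + 1) * (‖z - x‖ / r) ^ i := by
          rw [pow_add r, pow_add ‖z - x‖, div_pow, div_pow]; field_simp
      _ ≤ _ := by gcongr

/-- The point `z` may lie outside the disc, where the Taylor series says nothing: there `2 * ‖z - x‖
/ r ≥ 1`, so its `j`-th power absorbs `f z` and every Taylor term. One order is lost, but domination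
after division by `‖z - x‖ ^ j` needs no more. -/
theorem norm_sub_taylor_le {f : ℂ → ℂ} {x : ℂ} {r M M' : ℝ} (hr : 0 < r)
    (hf : ∀ z ∈ Metric.closedBall x r, DifferentiableAt ℂ f z)
    (hM : ∀ z ∈ Metric.closedBall x r, ‖f z‖ ≤ M) (hMM' : M ≤ M') (j : ℕ) {z : ℂ}
    (hz : ‖f z‖ ≤ M') :
    ‖f z - ∑ i ∈ range (j + 1), taylorCoeffAt f x i * (z - x) ^ i‖
      ≤ (j + 2) * M' * (2 * ‖z - x‖ / r) ^ j := by
  have hM0 : 0 ≤ M := (norm_nonneg _).trans (hM x (by simp [hr.le]))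
  have hM0' := hM0.trans hMM'
  rcases le_total ‖z - x‖ (r / 2) with h | h
  · refine (norm_sub_taylor_le_of_lt hr hf hM j h).trans ?_
    have hq : ‖z - x‖ / r ≤ 1 := by rw [div_le_iff₀ hr]; linarith
    have hq0 : 0 ≤ ‖z - x‖ / r := by positivity
    have h1 : (‖z - x‖ / r) ^ (j + 1) ≤ (2 * ‖z - x‖ / r) ^ j := by
      rw [pow_succ]
      refine (mul_le_of_le_one_right (by positivity) hq).trans ?_
      gcongr
      linarith [norm_nonneg (z - x)]
    have h2 : 2 * M ≤ (j + 2) * M' := by nlinarith [(Nat.cast_nonneg j : (0 : ℝ) ≤ j)]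
    exact mul_le_mul h2 h1 (by positivity) (by positivity)
  · have hq : 1 ≤ 2 * ‖z - x‖ / r := by rw [le_div_iff₀ hr]; linarith
    have h1 : ∀ i ∈ range (j + 1), ‖taylorCoeffAt f x i * (z - x) ^ i‖
        ≤ M' * (2 * ‖z - x‖ / r) ^ j := by
      intro i hi
      rw [norm_mul, norm_pow]
      calc _ ≤ M' / r ^ i * ‖z - x‖ ^ i := by
            gcongr
            exact (norm_taylorCoeffAt_le hr hf hM i).trans (by gcongr)
        _ = M' * (‖z - x‖ / r) ^ i := by rw [div_pow]; field_simp
        _ ≤ M' * (2 * ‖z - x‖ / r) ^ i := by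
            gcongr; linarith [norm_nonneg (z - x)]
        _ ≤ _ := by
            gcongr
            · exact Nat.lt_succ_iff.mp (mem_range.mp hi)
    have h2 := norm_sum_le_of_le _ h1
    rw [sum_const, card_range, nsmul_eq_mul] at h2
    have h3 : M' ≤ M' * (2 * ‖z - x‖ / r) ^ j :=
      le_mul_of_one_le_right hM0' (one_le_pow₀ hq)
    have h4 := norm_sub_le (f z) (∑ i ∈ range (j + 1), taylorCoeffAt f x i * (z - x) ^ i)
    push_cast at h2
    linarith

/-! ### Taylor expansion of a single term -/

/-- The `n`-th term `sec (π n w) / n ^ s` of the secant Dirichlet series at a complex point. -/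
noncomputable def complexSecantTerm (s n : ℕ) (w : ℂ) : ℂ :=
  (Complex.cos (Real.pi * n * w))⁻¹ / (n : ℂ) ^ s

theorem differentiableAt_complexSecantTerm (s n : ℕ) {w : ℂ}
    (hw : Complex.cos (Real.pi * n * w) ≠ 0) :
    DifferentiableAt ℂ (complexSecantTerm s n) w := by
  unfold complexSecantTerm
  fun_prop (disch := assumption)

/-- For real points the Taylor coefficients are those of the real function. -/
theorem iteratedDeriv_complexSecantTerm_ofReal (s n i : ℕ) {x : ℝ}
    (hx : Real.cos (Real.pi * n * x) ≠ 0) :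
    iteratedDeriv i (complexSecantTerm s n) x = secantTermD i s n x := by
  have hopen : IsOpen {w : ℂ | Complex.cos (Real.pi * n * w) ≠ 0} :=
    isOpen_ne_fun (by fun_prop) continuous_const
  have hcos (y : ℝ) : Complex.cos (Real.pi * n * y) = (Real.cos (Real.pi * n * y) : ℝ) := by
    push_cast; rfl
  unfold secantTermD
  induction i generalizing x with
  | zero =>
    simp only [iteratedDeriv_zero, complexSecantTerm, secantTerm, hcos]
    push_cast
    rfl
  | succ i ih =>
    rw [iteratedDeriv_succ, iteratedDeriv_succ]
    have hd : HasDerivAt (iteratedDeriv i (complexSecantTerm s n))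
        (deriv (iteratedDeriv i (complexSecantTerm s n)) x) x := by
      have han : AnalyticAt ℂ (complexSecantTerm s n) x := by
        apply DifferentiableOn.analyticAt (s := {w : ℂ | Complex.cos (Real.pi * n * w) ≠ 0})
        · exact fun w hw => (differentiableAt_complexSecantTerm s n hw).differentiableWithinAt
        · refine hopen.mem_nhds ?_
          change Complex.cos _ ≠ 0
          rw [hcos]
          exact_mod_cast hx
      rw [iteratedDeriv_eq_iterate]
      exact (AnalyticAt.iterated_deriv han i).differentiableAt.hasDerivAt
    have hev : (fun y : ℝ => iteratedDeriv i (complexSecantTerm s n) y) =ᶠ[𝓝 x]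
        fun y : ℝ => ((iteratedDeriv i (secantTerm s n) y : ℝ) : ℂ) := by
      have : ∀ᶠ y : ℝ in 𝓝 x, Real.cos (Real.pi * n * y) ≠ 0 :=
        ContinuousAt.eventually_ne (by fun_prop) hx
      filter_upwards [this] with y hy using ih hy
    have h1 := hd.comp_ofReal.congr_of_eventuallyEq hev.symm
    -- Along the real axis the previous derivative is real: real parts give the real derivative, and
    -- imaginary parts show that the complex one is real.
    have hre : HasDerivAt (iteratedDeriv i (secantTerm s n)) _ x :=
      Complex.reCLM.hasFDerivAt.comp_hasDerivAt x h1
    have him : HasDerivAt (fun _ : ℝ => (0 : ℝ)) _ x :=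
      Complex.imCLM.hasFDerivAt.comp_hasDerivAt x h1
    rw [hre.deriv]
    exact Complex.ext rfl (him.unique (hasDerivAt_const x 0))

theorem taylorCoeffAt_complexSecantTerm (s n i : ℕ) {x : ℝ}
    (hx : Real.cos (Real.pi * n * x) ≠ 0) :
    taylorCoeffAt (complexSecantTerm s n) x i = ((secantTermD i s n x / i.factorial : ℝ) : ℂ) := by
  rw [taylorCoeffAt, iteratedDeriv_complexSecantTerm_ofReal s n i hx]
  push_cast
  ring

theorem norm_pi_mul_sub (n : ℕ) (w : ℂ) (x : ℝ) :
    ‖Real.pi * n * w - (Real.pi * n * x : ℝ)‖ = Real.pi * n * ‖w - x‖ := by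
  have : (Real.pi * n * w - (Real.pi * n * x : ℝ) : ℂ) = (Real.pi * n : ℝ) * (w - x) := by
    push_cast; ring
  rw [this, norm_mul, Complex.norm_real, Real.norm_of_nonneg (by positivity)]

theorem norm_complexSecantTerm_le {s n : ℕ} {w : ℂ} {d : ℝ} (hd : 0 < d)
    (h : d ≤ ‖Complex.cos (Real.pi * n * w)‖) :
    ‖complexSecantTerm s n w‖ ≤ 1 / d / n ^ s := by
  rw [complexSecantTerm, norm_div, norm_inv, norm_pow, Complex.norm_natCast, ← one_div]
  gcongr

theorem norm_cos_ge_of_mem_closedBall {n : ℕ} (hn : 0 < n) {x : ℝ} {w : ℂ}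
    (hw : w ∈ Metric.closedBall (x : ℂ) (|Real.cos (Real.pi * n * x)| / (4 * (Real.pi * n)))) :
    |Real.cos (Real.pi * n * x)| / 2 ≤ ‖Complex.cos (Real.pi * n * w)‖ := by
  apply norm_cos_ge_of_le
  rw [norm_pi_mul_sub]
  rw [Metric.mem_closedBall, dist_eq_norm, le_div_iff₀ (by positivity)] at hw
  linarith

section Term

variable {s n : ℕ} {x : ℝ}

theorem differentiableAt_complexSecantTerm_of_mem_closedBall (hn : 0 < n) (hx : Real.cos (Real.pi * n * x) ≠ 0) :
    ∀ w ∈ Metric.closedBall (x : ℂ) (|Real.cos (Real.pi * n * x)| / (4 * (Real.pi * n))),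
      DifferentiableAt ℂ (complexSecantTerm s n) w := fun w hw => by
  apply differentiableAt_complexSecantTerm
  rw [← norm_pos_iff]
  exact lt_of_lt_of_le (by positivity) (norm_cos_ge_of_mem_closedBall hn hw)

theorem norm_complexSecantTerm_le_of_mem_closedBall (hn : 0 < n) (hx : Real.cos (Real.pi * n * x) ≠ 0) :
    ∀ w ∈ Metric.closedBall (x : ℂ) (|Real.cos (Real.pi * n * x)| / (4 * (Real.pi * n))),
      ‖complexSecantTerm s n w‖ ≤ 1 / (|Real.cos (Real.pi * n * x)| / 2) / n ^ s :=
  fun _ hw => norm_complexSecantTerm_le (by positivity) (norm_cos_ge_of_mem_closedBall hn hw)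

theorem abs_secantTermD_le (hn : 0 < n) (hx : Real.cos (Real.pi * n * x) ≠ 0) (i : ℕ) :
    |secantTermD i s n x| ≤ i.factorial * 2 * (4 * Real.pi) ^ i *
      ((n : ℝ) ^ i / ((n : ℝ) ^ s * |Real.cos (Real.pi * n * x)| ^ (i + 1))) := by
  have h := norm_taylorCoeffAt_le (f := complexSecantTerm s n) (by positivity)
    (differentiableAt_complexSecantTerm_of_mem_closedBall hn hx) (norm_complexSecantTerm_le_of_mem_closedBall hn hx) i
  rw [taylorCoeffAt_complexSecantTerm s n i hx, Complex.norm_real, norm_div, Real.norm_eq_abs,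
    Real.norm_natCast, div_le_iff₀ (by positivity)] at h
  refine h.trans_eq ?_
  have : (0 : ℝ) < n := by exact_mod_cast hn
  rw [div_pow, mul_pow, mul_pow, mul_pow, pow_succ]
  field_simp

theorem norm_complexSecantTerm_le_of_cone (hn : 0 < n) (hx : Real.cos (Real.pi * n * x) ≠ 0)
    {w : ℂ} (hw : ‖w - x‖ ≤ 2 * w.im) :
    ‖complexSecantTerm s n w‖ ≤ 1 / (|Real.cos (Real.pi * n * x)| / 8) / n ^ s := by
  refine norm_complexSecantTerm_le (by positivity) (norm_cos_ge_of_norm_sub_le_im ?_)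
  rw [norm_pi_mul_sub]
  have : (Real.pi * n * w : ℂ).im = Real.pi * n * w.im := by
    simp [Complex.mul_im]
  rw [this]
  nlinarith [(by positivity : 0 < Real.pi * n)]

/-- After division by `‖w - x‖ ^ j` the bound no longer depends on `w`: this is the majorant for
dominated convergence. -/
theorem norm_complexSecantTerm_sub_le (hn : 0 < n) (hx : Real.cos (Real.pi * n * x) ≠ 0) (j : ℕ)
    {w : ℂ} (hw : ‖w - x‖ ≤ 2 * w.im) :
    ‖complexSecantTerm s n w - ∑ i ∈ range (j + 1),
        ((secantTermD i s n x / i.factorial : ℝ) : ℂ) * (w - x) ^ i‖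
      ≤ (j + 2) * 8 * (8 * Real.pi) ^ j *
      ((n : ℝ) ^ j / ((n : ℝ) ^ s * |Real.cos (Real.pi * n * x)| ^ (j + 1))) * ‖w - x‖ ^ j := by
  have h := norm_sub_taylor_le (f := complexSecantTerm s n) (by positivity)
    (differentiableAt_complexSecantTerm_of_mem_closedBall hn hx) (norm_complexSecantTerm_le_of_mem_closedBall hn hx)
    (M' := 1 / (|Real.cos (Real.pi * n * x)| / 8) / n ^ s) (by gcongr; norm_num) j
    (norm_complexSecantTerm_le_of_cone hn hx hw)
  simp only [taylorCoeffAt_complexSecantTerm s n _ hx] at h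
  refine h.trans_eq ?_
  have : (0 : ℝ) < n := by exact_mod_cast hn
  rw [div_pow, div_pow, mul_pow, mul_pow, mul_pow, mul_pow, pow_succ]
  have h8 : (8 : ℝ) ^ j = 4 ^ j * 2 ^ j := by rw [← mul_pow]; norm_num
  rw [h8]
  field_simp

theorem tendsto_complexSecantTerm_sub (hn : 0 < n) (hx : Real.cos (Real.pi * n * x) ≠ 0) (j : ℕ)
    (S : Set ℂ) :
    Tendsto (fun w : ℂ => (complexSecantTerm s n w - ∑ i ∈ range (j + 1),
        ((secantTermD i s n x / i.factorial : ℝ) : ℂ) * (w - x) ^ i) / (w - x) ^ j)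
      (𝓝[S] (x : ℂ)) (𝓝 0) := by
  set r := |Real.cos (Real.pi * n * x)| / (4 * (Real.pi * n)) with hr
  set M := 1 / (|Real.cos (Real.pi * n * x)| / 2) / (n : ℝ) ^ s with hM
  have hr0 : 0 < r := by positivity
  have hM0 : 0 ≤ M := by positivity
  have hlim : Tendsto (fun w : ℂ => 2 * M / r ^ (j + 1) * ‖w - x‖) (𝓝[S] (x : ℂ)) (𝓝 0) := by
    have : Continuous fun w : ℂ => 2 * M / r ^ (j + 1) * ‖w - x‖ := by fun_prop
    have h := (this.tendsto (x : ℂ)).mono_left (nhdsWithin_le_nhds (s := S))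
    simpa using h
  refine squeeze_zero_norm' ?_ hlim
  have hball : Metric.closedBall (x : ℂ) (r / 2) ∈ 𝓝[S] (x : ℂ) :=
    mem_nhdsWithin_of_mem_nhds (Metric.closedBall_mem_nhds _ (by positivity))
  filter_upwards [hball] with w hw
  rw [Metric.mem_closedBall, dist_eq_norm] at hw
  have h := norm_sub_taylor_le_of_lt (f := complexSecantTerm s n) hr0
    (differentiableAt_complexSecantTerm_of_mem_closedBall hn hx) (norm_complexSecantTerm_le_of_mem_closedBall hn hx) j hw
  simp only [taylorCoeffAt_complexSecantTerm s n _ hx] at h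
  rw [norm_div, norm_pow]
  refine div_le_of_le_mul₀ (by positivity) (by positivity) (h.trans_eq ?_)
  rw [div_pow, pow_succ ‖w - x‖]
  ring

end Term

/-! ### Nontangential expansion at a quadratic irrationality -/

/-- The secant Dirichlet series at complex points. -/
noncomputable def complexSecantDirichlet (s : ℕ) (w : ℂ) : ℂ :=
  ∑' n : ℕ, complexSecantTerm s (n + 1) w

theorem IsRealQuadraticIrrationality.summable_secantTermD {ρ : ℝ}
    (hρ : IsRealQuadraticIrrationality ρ) {j s : ℕ} (hjs : 2 * j + 2 ≤ s) :
    Summable fun n : ℕ => secantTermD j s (n + 1) ρ :=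
  Summable.of_norm_bounded ((hρ.summable_pow_div_pow_mul_abs_cos_pow hjs).mul_left _)
    fun n => abs_secantTermD_le n.succ_pos (cos_pi_mul_ne_zero hρ.1 n.succ_pos) j

/-- Non-tangential Taylor expansion of the secant Dirichlet series at a real quadratic
irrationality. -/
theorem IsRealQuadraticIrrationality.tendsto_complexSecantDirichlet_sub {ρ : ℝ}
    (hρ : IsRealQuadraticIrrationality ρ) {j s : ℕ} (hjs : 2 * j + 2 ≤ s) :
    Tendsto (fun w : ℂ => (complexSecantDirichlet s w - ∑ i ∈ range (j + 1),
        ((secantDirichletD i s ρ / i.factorial : ℝ) : ℂ) * (w - ρ) ^ i) / (w - ρ) ^ j)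
      (𝓝[{w : ℂ | 0 < w.im ∧ ‖w - ρ‖ ≤ 2 * w.im}] (ρ : ℂ)) (𝓝 0) := by
  have hcos (n : ℕ) := cos_pi_mul_ne_zero hρ.1 n.succ_pos
  have h0 := tendsto_tsum_of_dominated_convergence
    (𝓕 := 𝓝[{w : ℂ | 0 < w.im ∧ ‖w - ρ‖ ≤ 2 * w.im}] (ρ : ℂ))
    (f := fun w n => (complexSecantTerm s (n + 1) w - ∑ i ∈ range (j + 1),
        ((secantTermD i s (n + 1) ρ / i.factorial : ℝ) : ℂ) * (w - ρ) ^ i) / (w - ρ) ^ j)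
    (g := fun _ => 0)
    ((hρ.summable_pow_div_pow_mul_abs_cos_pow hjs).mul_left ((j + 2) * 8 * (8 * Real.pi) ^ j))
    (fun n => tendsto_complexSecantTerm_sub n.succ_pos (hcos n) j _) ?_
  · rw [tsum_zero] at h0
    refine h0.congr' ?_
    filter_upwards [self_mem_nhdsWithin] with w hw
    rw [tsum_div_const]
    congr 1
    have hs1 : Summable fun n : ℕ => complexSecantTerm s (n + 1) w := by
      refine Summable.of_norm_bounded
        ((hρ.summable_pow_div_pow_mul_abs_cos_pow (j := 0) (s := s) (by omega)).mul_left 8)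
        fun n => (norm_complexSecantTerm_le_of_cone n.succ_pos (hcos n) hw.2).trans_eq ?_
      rw [pow_zero, zero_add, pow_one]
      have := hcos n
      field_simp
    have hs2 (i : ℕ) (hi : i ∈ range (j + 1)) : Summable fun n : ℕ =>
        ((secantTermD i s (n + 1) ρ / i.factorial : ℝ) : ℂ) * (w - ρ) ^ i := by
      refine Summable.mul_right _ (Complex.ofRealCLM.summable (Summable.div_const ?_ _))
      exact hρ.summable_secantTermD (by have := mem_range.mp hi; omega)
    rw [hs1.tsum_sub (summable_sum hs2), Summable.tsum_finsetSum hs2, complexSecantDirichlet]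
    congr 1
    refine sum_congr rfl fun i _ => ?_
    rw [tsum_mul_right, ← Complex.ofReal_tsum, tsum_div_const]
    rfl
  · filter_upwards [self_mem_nhdsWithin] with w hw n
    rw [norm_div, norm_pow]
    exact div_le_of_le_mul₀ (by positivity) (by positivity)
      (norm_complexSecantTerm_sub_le n.succ_pos (hcos n) j hw.2)

/-! ### Partial fractions of the secant -/

theorem mem_integerComplement_of_im_ne_zero {z : ℂ} (hz : z.im ≠ 0) :
    z ∈ Complex.integerComplement := by
  rintro ⟨n, rfl⟩
  simp at hz

theorem hasSum_cotTerm {z : ℂ} (hz : z ∈ Complex.integerComplement) :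
    HasSum (cotTerm z) (Real.pi * Complex.cot (Real.pi * z) - 1 / z) := by
  rw [cot_series_rep' hz]
  exact (summable_cotTerm hz).hasSum

/-- The two arguments sum to `π / 2`, so the numerator `sin (A + B)` is 1, and `2 * sin A * sin B =
cos (A - B)`. -/
theorem cot_add_cot {z : ℂ} (h1 : Complex.sin (Real.pi * ((1 + 2 * z) / 4)) ≠ 0)
    (h2 : Complex.sin (Real.pi * ((1 - 2 * z) / 4)) ≠ 0) :
    Complex.cot (Real.pi * ((1 + 2 * z) / 4)) + Complex.cot (Real.pi * ((1 - 2 * z) / 4))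
      = 2 * (Complex.cos (Real.pi * z))⁻¹ := by
  set A : ℂ := Real.pi * ((1 + 2 * z) / 4) with hA
  set B : ℂ := Real.pi * ((1 - 2 * z) / 4) with hB
  have hs : Complex.sin (A + B) = 1 := by
    rw [show A + B = (Real.pi / 2 : ℂ) by rw [hA, hB]; ring, Complex.sin_pi_div_two]
  have hc : Complex.cos (A + B) = 0 := by
    rw [show A + B = (Real.pi / 2 : ℂ) by rw [hA, hB]; ring, Complex.cos_pi_div_two]
  have hd : Complex.cos (Real.pi * z) = 2 * (Complex.sin A * Complex.sin B) := by
    rw [show (Real.pi * z : ℂ) = A - B by rw [hA, hB]; ring, Complex.cos_sub]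
    rw [Complex.cos_add] at hc
    linear_combination hc
  rw [Complex.sin_add] at hs
  rw [hd, Complex.cot_eq_cos_div_sin, Complex.cot_eq_cos_div_sin]
  field_simp
  linear_combination hs

/-- The odd number `2 * m + 1` as a complex number. -/
noncomputable def oddC (m : ℕ) : ℂ := ((2 * m + 1 : ℝ) : ℂ)

theorem oddC_ne_zero (m : ℕ) : oddC m ≠ 0 := by
  rw [oddC]
  exact_mod_cast (by positivity : (2 * m + 1 : ℝ) ≠ 0)

theorem norm_oddC (m : ℕ) : ‖oddC m‖ = 2 * m + 1 := by
  rw [oddC, Complex.norm_real, Real.norm_of_nonneg (by positivity)]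

theorem le_norm_oddC_sub {w : ℂ} (m : ℕ) : |w.im| ≤ ‖oddC m - w‖ := by
  have := Complex.abs_im_le_norm (oddC m - w)
  simpa [oddC] using this

/-- Dividing by `w` moves the growth in `m` into an imaginary part, that of `oddC m / w`. -/
theorem mul_le_norm_oddC_sub {w : ℂ} (hw : w ≠ 0) (m : ℕ) :
    (2 * m + 1) * |w.im| / ‖w‖ ≤ ‖oddC m - w‖ := by
  have h1 := Complex.abs_im_le_norm ((oddC m - w) / w)
  have h2 : ((oddC m - w) / w).im = -((2 * m + 1) * w.im / ‖w‖ ^ 2) := by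
    rw [sub_div, div_self hw, Complex.sub_im, Complex.one_im, sub_zero, Complex.div_im, oddC,
      Complex.ofReal_im, Complex.ofReal_re, ← Complex.normSq_eq_norm_sq]
    ring
  have h0 : 0 < ‖w‖ := norm_pos_iff.mpr hw
  rw [h2, norm_div, abs_neg, abs_div, abs_mul, abs_of_pos (by positivity : (0 : ℝ) < 2 * m + 1),
    abs_of_pos (by positivity : 0 < ‖w‖ ^ 2), div_le_div_iff₀ (by positivity) h0] at h1
  rw [div_le_iff₀ h0]
  nlinarith

theorem sq_im_le_norm_oddC_sq_sub (w : ℂ) (m : ℕ) : w.im ^ 2 ≤ ‖oddC m ^ 2 - w ^ 2‖ := by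
  have h1 := le_norm_oddC_sub (w := w) m
  have h2 := le_norm_oddC_sub (w := -w) m
  rw [Complex.neg_im, abs_neg] at h2
  rw [show oddC m ^ 2 - w ^ 2 = (oddC m - w) * (oddC m - -w) by ring, norm_mul, ← sq_abs, sq]
  exact mul_le_mul h1 h2 (abs_nonneg _) (norm_nonneg _)

theorem mul_sq_im_le_norm_oddC_sq_sub {w : ℂ} (hw : w ≠ 0) (m : ℕ) :
    (2 * m + 1) * w.im ^ 2 / ‖w‖ ≤ ‖oddC m ^ 2 - w ^ 2‖ := by
  have h1 := mul_le_norm_oddC_sub hw m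
  have h2 := le_norm_oddC_sub (w := -w) m
  rw [Complex.neg_im, abs_neg] at h2
  rw [show oddC m ^ 2 - w ^ 2 = (oddC m - w) * (oddC m - -w) by ring, norm_mul, ← sq_abs]
  calc _ = (2 * m + 1) * |w.im| / ‖w‖ * |w.im| := by ring
    _ ≤ _ := mul_le_mul h1 h2 (abs_nonneg _) (norm_nonneg _)

theorem oddC_sq_sub_ne_zero {w : ℂ} (hw : w.im ≠ 0) (m : ℕ) : oddC m ^ 2 - w ^ 2 ≠ 0 := by
  rw [← norm_pos_iff]
  exact lt_of_lt_of_le (by positivity) (sq_im_le_norm_oddC_sq_sub w m)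

theorem ne_zero_of_im_ne_zero {w : ℂ} (hw : w.im ≠ 0) : w ≠ 0 := fun h => by simp [h] at hw

theorem summable_one_div_odd_pow {p : ℕ} (hp : 2 ≤ p) :
    Summable fun m : ℕ => 1 / (2 * (m : ℝ) + 1) ^ p := by
  have h := (Real.summable_one_div_nat_pow.mpr (by omega : 1 < p)).comp_injective
    (i := fun m : ℕ => 2 * m + 1) (fun a b h => by simpa using h)
  refine h.congr fun m => ?_
  simp

theorem summable_sec_partial_fraction {w : ℂ} (hw : w.im ≠ 0) :
    Summable fun m : ℕ => (-1) ^ m * (w ^ 2 / (oddC m * (oddC m ^ 2 - w ^ 2))) := by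
  have hw0 := ne_zero_of_im_ne_zero hw
  have hn0 : 0 < ‖w‖ := norm_pos_iff.mpr hw0
  refine Summable.of_norm_bounded
    ((summable_one_div_odd_pow le_rfl).mul_left (‖w‖ ^ 3 / w.im ^ 2)) fun m => ?_
  rw [norm_mul, norm_pow, norm_neg, norm_one, one_pow, one_mul, norm_div, norm_mul, norm_pow,
    norm_oddC]
  calc _ ≤ ‖w‖ ^ 2 / ((2 * m + 1) * ((2 * m + 1) * w.im ^ 2 / ‖w‖)) := by
        gcongr
        exact mul_sq_im_le_norm_oddC_sq_sub hw0 m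
    _ = _ := by field_simp

theorem inv_add_inv_sub_eq {b w : ℂ} (hb : b ≠ 0) (h : b ^ 2 - w ^ 2 ≠ 0) :
    1 / ((b + w) / 4) + 1 / ((b - w) / 4) - 2 * (1 / (b / 4))
      = 8 * (w ^ 2 / (b * (b ^ 2 - w ^ 2))) := by
  have h1 : b + w ≠ 0 := fun h0 => h (by linear_combination (b - w) * h0)
  have h2 : b - w ≠ 0 := fun h0 => h (by linear_combination (b + w) * h0)
  rw [show b ^ 2 - w ^ 2 = (b + w) * (b - w) by ring]
  field_simp
  ring

/-- Partial fraction expansion of the secant. -/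
theorem hasSum_sec_partial_fraction {z : ℂ} (hz : z.im ≠ 0) :
    HasSum (fun m : ℕ => (-1) ^ m * ((2 * z) ^ 2 / (oddC m * (oddC m ^ 2 - (2 * z) ^ 2))))
      (Real.pi / 4 * ((Complex.cos (Real.pi * z))⁻¹ - 1)) := by
  have hw : (2 * z).im ≠ 0 := by simpa using hz
  have hi1 : (1 + 2 * z) / 4 ∈ Complex.integerComplement :=
    mem_integerComplement_of_im_ne_zero (by simpa using hz)
  have hi2 : (1 - 2 * z) / 4 ∈ Complex.integerComplement :=
    mem_integerComplement_of_im_ne_zero (by simpa using hz)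
  have hi3 : (1 / 4 : ℂ) ∈ Complex.integerComplement := by
    rintro ⟨n, hn⟩
    have h4 : (4 * n : ℂ) = 1 := by rw [hn]; norm_num
    have h5 : 4 * n = 1 := by exact_mod_cast h4
    omega
  have hs := summable_sec_partial_fraction hw
  set t : ℕ → ℂ := fun m : ℕ =>
    (-1) ^ m * ((2 * z) ^ 2 / (oddC m * (oddC m ^ 2 - (2 * z) ^ 2))) with ht
  have hnz (m : ℕ) := oddC_sq_sub_ne_zero hw m
  -- Subtracting twice the expansion at `1 / 4` makes the terms decay fast enough for absolute
  -- convergence. The poles at `±(n + 1)` yield the odd numbers `4 * n + 3` and `4 * n + 5`, with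
  -- opposite signs; the missing term `t 0` comes from the isolated `1 / z`.
  have h1 := ((hasSum_cotTerm hi1).add (hasSum_cotTerm hi2)).sub
    ((hasSum_cotTerm hi3).mul_left 2)
  have hterm (n : ℕ) : cotTerm ((1 + 2 * z) / 4) n + cotTerm ((1 - 2 * z) / 4) n
      - 2 * cotTerm (1 / 4) n = 8 * (t (2 * n + 1) + t (2 * n + 1 + 1)) := by
    have ha := inv_add_inv_sub_eq (oddC_ne_zero (2 * n + 1)) (hnz (2 * n + 1))
    have hb := inv_add_inv_sub_eq (oddC_ne_zero (2 * n + 1 + 1)) (hnz (2 * n + 1 + 1))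
    have e1 : (1 + 2 * z) / 4 - (n + 1) = -((oddC (2 * n + 1) - 2 * z) / 4) := by
      rw [oddC]; push_cast; ring
    have e2 : (1 - 2 * z) / 4 - (n + 1) = -((oddC (2 * n + 1) + 2 * z) / 4) := by
      rw [oddC]; push_cast; ring
    have e3 : (1 / 4 : ℂ) - (n + 1) = -(oddC (2 * n + 1) / 4) := by
      rw [oddC]; push_cast; ring
    have e4 : (1 + 2 * z) / 4 + (n + 1) = (oddC (2 * n + 1 + 1) + 2 * z) / 4 := by
      rw [oddC]; push_cast; ring
    have e5 : (1 - 2 * z) / 4 + (n + 1) = (oddC (2 * n + 1 + 1) - 2 * z) / 4 := by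
      rw [oddC]; push_cast; ring
    have e6 : (1 / 4 : ℂ) + (n + 1) = oddC (2 * n + 1 + 1) / 4 := by
      rw [oddC]; push_cast; ring
    have p1 : (-1 : ℂ) ^ (2 * n + 1) = -1 := Odd.neg_one_pow ⟨n, rfl⟩
    have p2 : (-1 : ℂ) ^ (2 * n + 1 + 1) = 1 := Even.neg_one_pow ⟨n + 1, by ring⟩
    simp only [cotTerm, ht]
    rw [e1, e2, e3, e4, e5, e6, p1, p2, one_div_neg_eq_neg_one_div, one_div_neg_eq_neg_one_div,
      one_div_neg_eq_neg_one_div]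
    linear_combination hb - ha
  have ht0 : 8 * t 0 = 1 / ((1 + 2 * z) / 4) + 1 / ((1 - 2 * z) / 4) - 2 * (1 / (1 / 4)) := by
    have h0 := inv_add_inv_sub_eq (oddC_ne_zero 0) (hnz 0)
    have e : oddC 0 = 1 := by simp [oddC]
    simp only [e, one_mul] at h0
    simp only [ht, e, pow_zero, one_mul]
    exact h0.symm
  have hcot4 : Complex.cot (Real.pi * (1 / 4)) = 1 := by
    rw [show (Real.pi * (1 / 4) : ℂ) = ((Real.pi / 4 : ℝ) : ℂ) by push_cast; ring,
      Complex.cot_eq_cos_div_sin, ← Complex.ofReal_cos, ← Complex.ofReal_sin,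
      Real.cos_pi_div_four, Real.sin_pi_div_four, div_self]
    exact_mod_cast (by positivity : √2 / 2 ≠ 0)
  have hcc := cot_add_cot (sin_pi_mul_ne_zero hi1) (sin_pi_mul_ne_zero hi2)
  have h2 : HasSum (fun n : ℕ => t (2 * n + 1) + t (2 * n + 1 + 1))
      (Real.pi / 4 * ((Complex.cos (Real.pi * z))⁻¹ - 1) - t 0) := by
    simp only [hterm] at h1
    rw [← hasSum_mul_left_iff (a₂ := (8 : ℂ)) (by norm_num)]
    have e : 8 * (Real.pi / 4 * ((Complex.cos (Real.pi * z))⁻¹ - 1) - t 0)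
        = Real.pi * Complex.cot (Real.pi * ((1 + 2 * z) / 4)) - 1 / ((1 + 2 * z) / 4)
          + (Real.pi * Complex.cot (Real.pi * ((1 - 2 * z) / 4)) - 1 / ((1 - 2 * z) / 4))
          - 2 * (Real.pi * Complex.cot (Real.pi * (1 / 4)) - 1 / (1 / 4)) := by
      rw [hcot4]
      linear_combination -ht0 - Real.pi * hcc
    rw [e]
    exact h1
  have hs1 : Summable fun m => t (m + 1) := (summable_nat_add_iff 1).mpr hs
  have h4 : HasSum (fun n : ℕ => t (2 * n + 1) + t (2 * n + 1 + 1)) (∑' m, t (m + 1)) := by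
    have he : Summable fun n : ℕ => t (2 * n + 1) :=
      hs.comp_injective (i := fun n : ℕ => 2 * n + 1) (fun a b h => by simpa using h)
    have ho : Summable fun n : ℕ => t (2 * n + 1 + 1) :=
      hs1.comp_injective (i := fun n : ℕ => 2 * n + 1) (fun a b h => by simpa using h)
    have := he.hasSum.add ho.hasSum
    rwa [tsum_even_add_odd (f := fun m => t (m + 1)) he ho] at this
  have h5 := h2.unique h4
  rw [hs.hasSum_iff, hs.tsum_eq_zero_add, ← h5]
  ring

/-! ### Special values and the double series -/

/-- A geometric series in `x / o ^ 2`, stopped after `L` terms: summed over `o`, these terms give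
`L`-values, and the tail gives the cotangent sum. -/
theorem geom_partial_fraction {o x : ℂ} (ho : o ≠ 0) (hx : o ^ 2 - x ≠ 0) (L : ℕ) :
    x / (o * (o ^ 2 - x)) = ∑ k ∈ range L, x ^ (k + 1) / o ^ (2 * k + 3)
      + x ^ (L + 1) / (o ^ (2 * L + 1) * (o ^ 2 - x)) := by
  induction L with
  | zero => simp
  | succ L ih =>
    rw [ih, sum_range_succ, add_assoc]
    congr 1
    field_simp
    ring

/-- The values at positive integers of the `L`-function of the nontrivial character mod 4. -/
noncomputable def dirichletBeta (p : ℕ) : ℂ := ∑' m : ℕ, (-1) ^ m / oddC m ^ p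

theorem summable_dirichletBeta {p : ℕ} (hp : 2 ≤ p) :
    Summable fun m : ℕ => (-1) ^ m / oddC m ^ p := by
  refine Summable.of_norm_bounded (summable_one_div_odd_pow hp) fun m => ?_
  rw [norm_div, norm_pow, norm_neg, norm_one, one_pow, norm_pow, norm_oddC]

/-- At `1 / 4` the sine Fourier series of an odd-index Bernoulli polynomial has coefficients `sin (π
n / 2)`, which is the character mod 4. -/
theorem exists_dirichletBeta_eq (k : ℕ) :
    ∃ q : ℚ, dirichletBeta (2 * k + 3) = Real.pi ^ (2 * k + 3) * q := by
  have h := hasSum_one_div_nat_pow_mul_sin (k := k + 1) (by omega) (x := 1 / 4)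
    ⟨by norm_num, by norm_num⟩
  set f : ℕ → ℝ := fun n => 1 / (n : ℝ) ^ (2 * (k + 1) + 1) * Real.sin (2 * Real.pi * n * (1 / 4))
    with hf
  have hodd (m : ℕ) : ((f (2 * m + 1) : ℝ) : ℂ) = (-1) ^ m / oddC m ^ (2 * k + 3) := by
    have : Real.sin (2 * Real.pi * (2 * m + 1 : ℕ) * (1 / 4)) = (-1) ^ m := by
      rw [show 2 * Real.pi * (2 * m + 1 : ℕ) * (1 / 4) = Real.pi / 2 + m * Real.pi by
        push_cast; ring, Real.sin_add_nat_mul_pi, Real.sin_pi_div_two, mul_one]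
    simp only [hf, this, oddC]
    push_cast
    ring
  have heven (m : ℕ) : f (2 * m) = 0 := by
    have : Real.sin (2 * Real.pi * (2 * m : ℕ) * (1 / 4)) = 0 := by
      rw [show 2 * Real.pi * (2 * m : ℕ) * (1 / 4) = m * Real.pi by push_cast; ring]
      exact Real.sin_nat_mul_pi m
    simp only [hf, this, mul_zero]
  have h2 : HasSum (fun m => f (2 * m + 1)) (∑' n, f n) := by
    have hs : Summable f := h.summable
    have he : Summable fun n : ℕ => f (2 * n) := by simp only [heven]; exact summable_zero
    have ho : Summable fun n : ℕ => f (2 * n + 1) :=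
      hs.comp_injective (i := fun n : ℕ => 2 * n + 1) (fun a b h => by simpa using h)
    rw [← tsum_even_add_odd he ho]
    simp only [heven, tsum_zero, zero_add]
    exact ho.hasSum
  rw [h.tsum_eq] at h2
  refine ⟨(-1) ^ (k + 1 + 1) * 2 ^ (2 * (k + 1) + 1) / 2 / (2 * (k + 1) + 1).factorial *
    (Polynomial.bernoulli (2 * (k + 1) + 1)).eval (1 / 4), ?_⟩
  have h3 := h2.map Complex.ofRealCLM Complex.ofRealCLM.continuous
  have h4 : dirichletBeta (2 * k + 3) = _ :=
    (tsum_congr fun m => (hodd m).symm).trans h3.tsum_eq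
  rw [h4]
  have h5 : Polynomial.eval (1 / 4 : ℝ)
      (Polynomial.map (algebraMap ℚ ℝ) (Polynomial.bernoulli (2 * (k + 1) + 1)))
      = (((Polynomial.bernoulli (2 * (k + 1) + 1)).eval (1 / 4) : ℚ) : ℝ) := by
    rw [Polynomial.eval_map_algebraMap,
      show (1 / 4 : ℝ) = algebraMap ℚ ℝ (1 / 4) by simp, Polynomial.aeval_algebraMap_apply]
    simp
  rw [h5]
  simp only [Complex.ofRealCLM_apply]
  push_cast
  rw [mul_pow]
  ring

theorem exists_hasSum_zeta_even (k : ℕ) :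
    ∃ q : ℚ, HasSum (fun n : ℕ => 1 / ((n + 1 : ℕ) : ℂ) ^ (2 * k + 2))
      (Real.pi ^ (2 * k + 2) * q) := by
  have h := hasSum_zeta_nat (k := k + 1) (by omega)
  rw [← hasSum_nat_add_iff' 1] at h
  have h2 := h.map Complex.ofRealCLM Complex.ofRealCLM.continuous
  refine ⟨(-1) ^ (k + 1 + 1) * 2 ^ (2 * (k + 1) - 1) * bernoulli (2 * (k + 1)) /
    (2 * (k + 1)).factorial, ?_⟩
  convert h2 using 1
  · ext n; simp [mul_add]
  · simp [mul_add]
    ring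

/-- The bound that makes the double series converge absolutely. -/
theorem one_div_norm_oddC_sq_sub_le {τ : ℂ} (hτ : 0 < τ.im) (m n : ℕ) :
    1 / ‖oddC m ^ 2 - (2 * ((n + 1 : ℕ) : ℂ) * τ) ^ 2‖ ≤
      (√(8 * τ.im ^ 4 / ‖τ‖))⁻¹ * (1 / (2 * (m : ℝ) + 1) ^ (1 / 2 : ℝ))
        * (1 / ((n + 1 : ℕ) : ℝ) ^ (3 / 2 : ℝ)) := by
  set N : ℝ := ((n + 1 : ℕ) : ℝ) with hN
  have hN0 : 0 < N := by positivity
  have hτ0 : 0 < ‖τ‖ := norm_pos_iff.mpr (ne_zero_of_im_ne_zero hτ.ne')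
  set w : ℂ := 2 * ((n + 1 : ℕ) : ℂ) * τ with hw
  have him : w.im = 2 * N * τ.im := by
    have : w = ((2 * N : ℝ) : ℂ) * τ := by rw [hw, hN]; push_cast; ring
    rw [this, Complex.im_ofReal_mul]
  have hnorm : ‖w‖ = 2 * N * ‖τ‖ := by
    have : w = ((2 * N : ℝ) : ℂ) * τ := by rw [hw, hN]; push_cast; ring
    rw [this, norm_mul, Complex.norm_real, Real.norm_of_nonneg (by positivity)]
  have hw0 : w ≠ 0 := ne_zero_of_im_ne_zero (by rw [him]; positivity)
  have h1 := sq_im_le_norm_oddC_sq_sub w m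
  have h2 := mul_sq_im_le_norm_oddC_sq_sub hw0 m
  rw [him] at h1 h2
  rw [hnorm] at h2
  set A := ‖oddC m ^ 2 - w ^ 2‖ with hA
  set o : ℝ := 2 * (m : ℝ) + 1 with ho
  have ho0 : 0 < o := by positivity
  -- The geometric mean of `h1` and `h2`. With one further factor `1 / o`, neither bound alone is
  -- summable over both indices, but the mean is.
  have h3 : √(8 * τ.im ^ 4 / ‖τ‖) * o ^ (1 / 2 : ℝ) * N ^ (3 / 2 : ℝ) ≤ A := by
    refine le_of_sq_le_sq ?_ (norm_nonneg _)
    rw [mul_pow, mul_pow, Real.sq_sqrt (by positivity), ← Real.rpow_natCast (o ^ (1 / 2 : ℝ)),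
      ← Real.rpow_natCast (N ^ (3 / 2 : ℝ)), ← Real.rpow_mul ho0.le, ← Real.rpow_mul hN0.le]
    norm_num
    rw [← Real.rpow_natCast N 3]
    calc _ = (2 * N * τ.im) ^ 2 * (o * (2 * N * τ.im) ^ 2 / (2 * N * ‖τ‖)) := by
          norm_num
          field_simp
          ring
      _ ≤ A * A := mul_le_mul h1 h2 (by positivity) (norm_nonneg _)
      _ = A ^ 2 := by ring
  have h4 : 0 < √(8 * τ.im ^ 4 / ‖τ‖) * o ^ (1 / 2 : ℝ) * N ^ (3 / 2 : ℝ) := by positivity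
  calc 1 / A ≤ 1 / (√(8 * τ.im ^ 4 / ‖τ‖) * o ^ (1 / 2 : ℝ) * N ^ (3 / 2 : ℝ)) := by gcongr
    _ = _ := by field_simp

theorem summable_double {τ : ℂ} (hτ : 0 < τ.im) {p : ℕ} (hp : 1 ≤ p) :
    Summable fun q : ℕ × ℕ =>
      (-1) ^ q.1 / (oddC q.1 ^ p * (oddC q.1 ^ 2 - (2 * ((q.2 + 1 : ℕ) : ℂ) * τ) ^ 2)) := by
  have h1 : Summable fun m : ℕ => 1 / (2 * (m : ℝ) + 1) ^ (3 / 2 : ℝ) := by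
    have h := (Real.summable_one_div_nat_rpow.mpr (by norm_num : (1 : ℝ) < 3 / 2)).comp_injective
      (i := fun m : ℕ => 2 * m + 1) (fun a b h => by simpa using h)
    refine h.congr fun m => ?_
    simp
  have h2 : Summable fun n : ℕ => 1 / ((n + 1 : ℕ) : ℝ) ^ (3 / 2 : ℝ) :=
    (summable_nat_add_iff 1).mpr (Real.summable_one_div_nat_rpow.mpr (by norm_num))
  have h3 := Summable.mul_of_nonneg h1 h2 (fun m => by positivity) (fun n => by positivity)
  refine Summable.of_norm_bounded (h3.mul_left (√(8 * τ.im ^ 4 / ‖τ‖))⁻¹) fun q => ?_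
  obtain ⟨m, n⟩ := q
  have hb := one_div_norm_oddC_sq_sub_le hτ m n
  simp only [norm_div, norm_mul, norm_pow, norm_neg, norm_one, one_pow, norm_oddC]
  set o : ℝ := 2 * (m : ℝ) + 1 with ho
  have ho1 : 1 ≤ o := by rw [ho]; linarith [(Nat.cast_nonneg m : (0 : ℝ) ≤ m)]
  have hsplit : o ^ (3 / 2 : ℝ) = o * o ^ (1 / 2 : ℝ) := by
    rw [show (3 / 2 : ℝ) = 1 + 1 / 2 by norm_num, Real.rpow_add (by positivity), Real.rpow_one]
  rw [← one_div_mul_one_div]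
  calc _ ≤ 1 / o * _ := by
        refine mul_le_mul ?_ hb (by positivity) (by positivity)
        gcongr
        exact le_self_pow₀ ho1 (by omega)
    _ = _ := by
        rw [hsplit]
        field_simp

/-- With `m` fixed, the sum over `n` is again a cotangent expansion, now at `oddC m / (2 * τ)`. -/
theorem hasSum_one_div_oddC_sq_sub {τ : ℂ} (hτ : 0 < τ.im) (m : ℕ) :
    HasSum (fun n : ℕ => 1 / (oddC m ^ 2 - (2 * ((n + 1 : ℕ) : ℂ) * τ) ^ 2))
      ((Real.pi * Complex.cot (Real.pi * (oddC m / (2 * τ))) - 2 * τ / oddC m)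
        / (4 * oddC m * τ)) := by
  have hτ0 := ne_zero_of_im_ne_zero hτ.ne'
  have ho := oddC_ne_zero m
  have hz : oddC m / (2 * τ) ∈ Complex.integerComplement := by
    rintro ⟨k, hk⟩
    have h1 : ((2 * k : ℝ) : ℂ) * τ = ((2 * m + 1 : ℝ) : ℂ) := by
      change _ = oddC m
      rw [eq_div_iff (by simpa using hτ0)] at hk
      rw [← hk]; push_cast; ring
    have h2 := congrArg Complex.im h1
    rw [Complex.im_ofReal_mul, Complex.ofReal_im] at h2
    have h3 : (2 * k : ℝ) = 0 := by
      rcases mul_eq_zero.mp h2 with h | h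
      · exact h
      · exact absurd h hτ.ne'
    rw [h3, Complex.ofReal_zero, zero_mul] at h1
    exact ho h1.symm
  have h := (hasSum_cotTerm hz).div_const (4 * oddC m * τ)
  have e1 : (fun n : ℕ => cotTerm (oddC m / (2 * τ)) n / (4 * oddC m * τ))
      = fun n : ℕ => 1 / (oddC m ^ 2 - (2 * ((n + 1 : ℕ) : ℂ) * τ) ^ 2) := by
    ext n
    have h0 := oddC_sq_sub_ne_zero (w := 2 * ((n + 1 : ℕ) : ℂ) * τ)
      (by
        rw [show (2 * ((n + 1 : ℕ) : ℂ) * τ) = ((2 * (n + 1) : ℝ) : ℂ) * τ by push_cast; ring,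
          Complex.im_ofReal_mul]
        positivity) m
    rw [show oddC m ^ 2 - (2 * ((n + 1 : ℕ) : ℂ) * τ) ^ 2
        = (oddC m - 2 * (n + 1) * τ) * (oddC m + 2 * (n + 1) * τ) by push_cast; ring] at h0 ⊢
    have h1 := left_ne_zero_of_mul h0
    have h2 := right_ne_zero_of_mul h0
    have e1 : oddC m / (2 * τ) - (n + 1) = (oddC m - 2 * (n + 1) * τ) / (2 * τ) := by
      field_simp
    have e2 : oddC m / (2 * τ) + (n + 1) = (oddC m + 2 * (n + 1) * τ) / (2 * τ) := by
      field_simp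
    simp only [cotTerm]
    rw [e1, e2]
    field_simp
    ring
  rw [e1] at h
  rwa [one_div_div] at h

/-- The cotangent series occurring in the transformation formula of the secant series. -/
noncomputable def oddCotSum (s : ℕ) (τ : ℂ) : ℂ :=
  ∑' m : ℕ, (-1) ^ m / oddC m ^ s * Complex.cot (Real.pi * (oddC m / (2 * τ)))

theorem tsum_tsum_eq_oddCotSum {τ : ℂ} (hτ : 0 < τ.im) {p : ℕ} (hp : 1 ≤ p) :
    ∑' n : ℕ, ∑' m : ℕ,
      (-1) ^ m / (oddC m ^ p * (oddC m ^ 2 - (2 * ((n + 1 : ℕ) : ℂ) * τ) ^ 2))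
      = Real.pi / (4 * τ) * oddCotSum (p + 1) τ - dirichletBeta (p + 2) / 2 := by
  have hτ0 := ne_zero_of_im_ne_zero hτ.ne'
  have hd := summable_double hτ hp
  have h1 : ∀ m : ℕ, HasSum (fun n : ℕ =>
      (-1) ^ m / (oddC m ^ p * (oddC m ^ 2 - (2 * ((n + 1 : ℕ) : ℂ) * τ) ^ 2)))
      (Real.pi / (4 * τ) * ((-1) ^ m / oddC m ^ (p + 1)
        * Complex.cot (Real.pi * (oddC m / (2 * τ)))) - (-1) ^ m / oddC m ^ (p + 2) / 2) := by
    intro m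
    have ho := oddC_ne_zero m
    have h := (hasSum_one_div_oddC_sq_sub hτ m).mul_left ((-1) ^ m / oddC m ^ p)
    simp only [div_mul_div_comm, mul_one] at h
    have e : (-1) ^ m * (Real.pi * Complex.cot (Real.pi * (oddC m / (2 * τ))) - 2 * τ / oddC m)
        / (oddC m ^ p * (4 * oddC m * τ)) = Real.pi / (4 * τ) * ((-1) ^ m / oddC m ^ (p + 1)
        * Complex.cot (Real.pi * (oddC m / (2 * τ)))) - (-1) ^ m / oddC m ^ (p + 2) / 2 := by
      field_simp
      ring
    rwa [e] at h
  have h2 := hd.hasSum.prod_fiberwise h1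
  have hb := (summable_dirichletBeta (p := p + 2) (by omega)).hasSum.div_const 2
  have h3 := h2.add hb
  simp only [sub_add_cancel] at h3
  have h4 := h3.tsum_eq
  rw [tsum_mul_left] at h4
  rw [Summable.tsum_comm (by exact hd), ← hd.tsum_prod]
  rw [oddCotSum, h4, dirichletBeta]
  ring

/-- The truncation order matches the exponent: the power of `n + 1` in the tail cancels the
denominator exactly, while the other terms keep even zeta exponents. -/
theorem complexSecantTerm_eq (L n : ℕ) {τ : ℂ} (hτ : 0 < τ.im) :
    complexSecantTerm (2 * L + 2) (n + 1) τ = 1 / ((n + 1 : ℕ) : ℂ) ^ (2 * L + 2)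
      + 4 / Real.pi * (∑ k ∈ range L, (4 * τ ^ 2) ^ (k + 1) * dirichletBeta (2 * k + 3)
          * (1 / ((n + 1 : ℕ) : ℂ) ^ (2 * (L - 1 - k) + 2))
        + (4 * τ ^ 2) ^ (L + 1) * ∑' m : ℕ, (-1) ^ m / (oddC m ^ (2 * L + 1) *
            (oddC m ^ 2 - (2 * ((n + 1 : ℕ) : ℂ) * τ) ^ 2))) := by
  set N : ℂ := ((n + 1 : ℕ) : ℂ) with hN
  have hN0 : N ≠ 0 := Nat.cast_ne_zero.mpr n.succ_ne_zero
  have him : (N * τ).im ≠ 0 := by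
    rw [show N * τ = ((n + 1 : ℝ) : ℂ) * τ by rw [hN]; push_cast; ring, Complex.im_ofReal_mul]
    positivity
  have him2 : (2 * N * τ).im ≠ 0 := by
    rw [mul_assoc]; simpa using him
  have hpi : (Real.pi : ℂ) ≠ 0 := by exact_mod_cast Real.pi_ne_zero
  have h1 := hasSum_sec_partial_fraction him
  rw [← mul_assoc, ← mul_assoc] at h1
  have h2 : HasSum (fun m : ℕ => ∑ k ∈ range L, ((2 * N * τ) ^ 2) ^ (k + 1) *
      ((-1) ^ m / oddC m ^ (2 * k + 3)) + ((2 * N * τ) ^ 2) ^ (L + 1) *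
      ((-1) ^ m / (oddC m ^ (2 * L + 1) * (oddC m ^ 2 - (2 * N * τ) ^ 2))))
      (∑ k ∈ range L, ((2 * N * τ) ^ 2) ^ (k + 1) * dirichletBeta (2 * k + 3)
        + ((2 * N * τ) ^ 2) ^ (L + 1) * ∑' m : ℕ, (-1) ^ m / (oddC m ^ (2 * L + 1) *
            (oddC m ^ 2 - (2 * N * τ) ^ 2))) := by
    refine HasSum.add (hasSum_sum fun k _ =>
      (summable_dirichletBeta (by omega)).hasSum.mul_left _) (HasSum.mul_left _ ?_)
    exact ((summable_double hτ (p := 2 * L + 1) (by omega)).comp_injective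
      (i := fun m : ℕ => (m, n)) fun a b h => by simpa using h).hasSum
  have h3 : (fun m : ℕ => (-1) ^ m * ((2 * N * τ) ^ 2 /
      (oddC m * (oddC m ^ 2 - (2 * N * τ) ^ 2))))
      = fun m : ℕ => ∑ k ∈ range L, ((2 * N * τ) ^ 2) ^ (k + 1) *
      ((-1) ^ m / oddC m ^ (2 * k + 3)) + ((2 * N * τ) ^ 2) ^ (L + 1) *
      ((-1) ^ m / (oddC m ^ (2 * L + 1) * (oddC m ^ 2 - (2 * N * τ) ^ 2))) := by
    ext m
    rw [geom_partial_fraction (oddC_ne_zero m) (oddC_sq_sub_ne_zero him2 m) L, mul_add, mul_sum]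
    congr 1
    · exact sum_congr rfl fun k _ => by ring
    · ring
  rw [h3] at h1
  have h4 := h1.unique h2
  have h5 : (Complex.cos (Real.pi * N * τ))⁻¹ = 1 + 4 / Real.pi *
      (∑ k ∈ range L, ((2 * N * τ) ^ 2) ^ (k + 1) * dirichletBeta (2 * k + 3)
        + ((2 * N * τ) ^ 2) ^ (L + 1) * ∑' m : ℕ, (-1) ^ m / (oddC m ^ (2 * L + 1) *
            (oddC m ^ 2 - (2 * N * τ) ^ 2))) := by
    rw [← h4]
    field_simp
    ring
  rw [complexSecantTerm, ← hN, h5, add_div, mul_div_assoc, add_div, sum_div]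
  have hx : (2 * N * τ) ^ 2 = N ^ 2 * (4 * τ ^ 2) := by ring
  congr 3
  · refine sum_congr rfl fun k hk => ?_
    have hk' := mem_range.mp hk
    obtain ⟨d, rfl⟩ : ∃ d, L = k + 1 + d := ⟨L - (k + 1), by omega⟩
    rw [show k + 1 + d - 1 - k = d by omega,
      show 2 * (k + 1 + d) + 2 = 2 * (k + 1) + (2 * d + 2) by ring, pow_add N, hx, mul_pow (N ^ 2),
      pow_mul N 2]
    field_simp
  · rw [mul_div_right_comm, show 2 * L + 2 = 2 * (L + 1) by ring, pow_mul N, ← div_pow, hx,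
      mul_div_cancel_left₀ _ (pow_ne_zero 2 hN0)]

/-- Interchanging summations leaves one monomial of degree `2 * L + 2`, too high for weight `-(2 * L
+ 1)`; it is moved to the left. -/
theorem exists_complexSecantDirichlet_eq (L : ℕ) : ∃ (e : ℕ → ℚ) (c : ℚ), ∀ τ : ℂ, 0 < τ.im →
    complexSecantDirichlet (2 * L + 2) τ + Real.pi ^ (2 * L + 2) * (c * τ ^ (2 * L + 2))
      = Real.pi ^ (2 * L + 2) * ∑ k ∈ range (L + 1), e k * τ ^ (2 * k)
        + 4 ^ (L + 1) * τ ^ (2 * L + 1) * oddCotSum (2 * L + 2) τ := by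
  choose z hz using exists_hasSum_zeta_even
  choose b hb using exists_dirichletBeta_eq
  refine ⟨fun k => if k = 0 then z L else 4 ^ (k + 1) * b (k - 1) * z (L - k),
    2 * 4 ^ (L + 1) * b L, fun τ hτ => ?_⟩
  have hτ0 := ne_zero_of_im_ne_zero hτ.ne'
  have hpi : (Real.pi : ℂ) ≠ 0 := by exact_mod_cast Real.pi_ne_zero
  have hd := summable_double hτ (p := 2 * L + 1) (by omega)
  have hD : HasSum (fun n : ℕ => ∑' m : ℕ, (-1) ^ m / (oddC m ^ (2 * L + 1) *
            (oddC m ^ 2 - (2 * ((n + 1 : ℕ) : ℂ) * τ) ^ 2)))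
      (Real.pi / (4 * τ) * oddCotSum (2 * L + 2) τ - dirichletBeta (2 * L + 3) / 2) := by
    rw [← tsum_tsum_eq_oddCotSum hτ (p := 2 * L + 1) (by omega)]
    exact hd.prod_symm.prod.hasSum
  have h := (hz L).add (((hasSum_sum fun k (_ : k ∈ range L) => (hz (L - 1 - k)).mul_left
    ((4 * τ ^ 2) ^ (k + 1) * dirichletBeta (2 * k + 3))).add
    (hD.mul_left ((4 * τ ^ 2) ^ (L + 1)))).mul_left (4 / (Real.pi : ℂ)))
  rw [complexSecantDirichlet, tsum_congr fun n => complexSecantTerm_eq L n hτ, h.tsum_eq,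
    sum_range_succ', hb]
  have hsum : 4 / (Real.pi : ℂ) * ∑ k ∈ range L, (4 * τ ^ 2) ^ (k + 1)
      * dirichletBeta (2 * k + 3) * (Real.pi ^ (2 * (L - 1 - k) + 2) * z (L - 1 - k))
      = Real.pi ^ (2 * L + 2) * ∑ k ∈ range L,
        ((4 ^ (k + 1 + 1) * b k * z (L - (k + 1)) : ℚ) : ℂ) * τ ^ (2 * (k + 1)) := by
    rw [mul_sum, mul_sum]
    refine sum_congr rfl fun k hk => ?_
    have hk' := mem_range.mp hk
    obtain ⟨d, rfl⟩ : ∃ d, L = k + 1 + d := ⟨L - (k + 1), by omega⟩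
    rw [hb, show k + 1 + d - 1 - k = d by omega, show k + 1 + d - (k + 1) = d by omega, mul_pow,
      ← pow_mul]
    push_cast
    field_simp
    ring
  rw [mul_add (4 / (Real.pi : ℂ)), hsum]
  simp only [Nat.add_eq_zero_iff, one_ne_zero, and_false, if_false, Nat.add_sub_cancel, if_true]
  push_cast
  rw [mul_pow, ← pow_mul]
  field_simp
  ring

/-! ### Period polynomials for the level 2 group -/

/-- `F` transforms like an Eichler integral of weight `-N` under the Möbius transformation with
matrix `(a, b; c, d)`, with a rational period polynomial up to the factor `κ`. -/
def HasRationalPeriod (F : ℂ → ℂ) (κ : ℂ) (N : ℕ) (a b c d : ℤ) : Prop :=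
  ∃ σ : ℤ, (σ = 1 ∨ σ = -1) ∧ ∃ p : Polynomial ℚ, ∀ τ : ℂ, 0 < τ.im →
    (c * τ + d) ^ N * F ((a * τ + b) / (c * τ + d)) = σ * F τ + κ * Polynomial.aeval τ p

/-- The degree bound lets `(c * τ + d) ^ N` clear all denominators, so polynomial defects of
generators stay polynomial under composition. -/
theorem exists_homogenization (p : Polynomial ℚ) {N : ℕ} (hp : p.natDegree ≤ N) (a b c d : ℤ) :
    ∃ q : Polynomial ℚ, ∀ τ : ℂ, c * τ + d ≠ 0 →
      (c * τ + d) ^ N * Polynomial.aeval ((a * τ + b) / (c * τ + d)) p = Polynomial.aeval τ q := by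
  refine ⟨∑ i ∈ range (N + 1), Polynomial.C (p.coeff i) *
    (Polynomial.C (a : ℚ) * Polynomial.X + Polynomial.C (b : ℚ)) ^ i *
    (Polynomial.C (c : ℚ) * Polynomial.X + Polynomial.C (d : ℚ)) ^ (N - i), fun τ hτ => ?_⟩
  rw [Polynomial.aeval_eq_sum_range' (Nat.lt_succ_of_le hp), mul_sum, map_sum]
  refine sum_congr rfl fun i hi => ?_
  obtain ⟨k, rfl⟩ : ∃ k, N = i + k := ⟨N - i, by have := mem_range.mp hi; omega⟩
  simp only [map_mul, map_pow, map_add, Polynomial.aeval_C, Polynomial.aeval_X,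
    Algebra.smul_def, eq_ratCast, Rat.cast_intCast, Nat.add_sub_cancel_left]
  rw [div_pow, pow_add]
  field_simp

theorem im_moebius {a b c d : ℤ} (h : a * d - b * c = 1) (τ : ℂ) :
    ((a * τ + b) / (c * τ + d) : ℂ).im = τ.im / Complex.normSq (c * τ + d) := by
  have h' : (a * d - b * c : ℝ) = 1 := by exact_mod_cast h
  rw [Complex.div_im]
  simp only [Complex.add_im, Complex.mul_im, Complex.intCast_re, Complex.intCast_im,
    Complex.add_re, Complex.mul_re]
  rw [← sub_div]
  congr 1
  linear_combination τ.im * h'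

theorem moebius_denom_ne_zero {a b c d : ℤ} (h : a * d - b * c = 1) {τ : ℂ} (hτ : 0 < τ.im) :
    (c * τ + d : ℂ) ≠ 0 := by
  intro h0
  have h1 := congrArg Complex.im h0
  have h2 := congrArg Complex.re h0
  simp at h1 h2
  rcases h1 with h1 | h1
  · subst h1
    simp at h2
    subst h2
    simp at h
  · exact hτ.ne' h1

theorem im_moebius_pos {a b c d : ℤ} (h : a * d - b * c = 1) {τ : ℂ} (hτ : 0 < τ.im) :
    0 < ((a * τ + b) / (c * τ + d) : ℂ).im := by
  rw [im_moebius h]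
  exact div_pos hτ (Complex.normSq_pos.mpr (moebius_denom_ne_zero h hτ))

section Generators

variable {F : ℂ → ℂ} {κ : ℂ} {N : ℕ}

theorem HasRationalPeriod.add_two_mul_left {a b c d ε : ℤ}
    (hA : ∃ p : Polynomial ℚ, p.natDegree ≤ N ∧ ∀ τ : ℂ, 0 < τ.im →
      F (τ + 2 * ε) = F τ + κ * Polynomial.aeval τ p)
    (hdet : a * d - b * c = 1) (h : HasRationalPeriod F κ N a b c d) :
    HasRationalPeriod F κ N (a + 2 * ε * c) (b + 2 * ε * d) c d := by
  obtain ⟨σ, hσ, p, hp⟩ := h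
  obtain ⟨pA, hdeg, hA⟩ := hA
  obtain ⟨q, hq⟩ := exists_homogenization pA hdeg a b c d
  refine ⟨σ, hσ, p + q, fun τ hτ => ?_⟩
  have h0 := moebius_denom_ne_zero hdet hτ
  have e : (((a + 2 * ε * c : ℤ) : ℂ) * τ + ((b + 2 * ε * d : ℤ) : ℂ)) / (c * τ + d)
      = (a * τ + b) / (c * τ + d) + 2 * ε := by
    push_cast
    field_simp
    ring
  rw [e, hA _ (im_moebius_pos hdet hτ), mul_add, hp τ hτ, mul_left_comm, hq τ h0, map_add]
  ring

theorem HasRationalPeriod.add_two_mul_right {a b c d ε : ℤ}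
    (hB : ∃ p : Polynomial ℚ, p.natDegree ≤ N ∧ ∀ τ : ℂ, 0 < τ.im →
      (2 * ε * τ + 1) ^ N * F (τ / (2 * ε * τ + 1)) = F τ + κ * Polynomial.aeval τ p)
    (hdet : a * d - b * c = 1) (h : HasRationalPeriod F κ N a b c d) :
    HasRationalPeriod F κ N a b (c + 2 * ε * a) (d + 2 * ε * b) := by
  obtain ⟨σ, hσ, p, hp⟩ := h
  obtain ⟨pB, hdeg, hB⟩ := hB
  obtain ⟨q, hq⟩ := exists_homogenization pB hdeg a b c d
  refine ⟨σ, hσ, p + q, fun τ hτ => ?_⟩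
  have h0 := moebius_denom_ne_zero hdet hτ
  have h1 := moebius_denom_ne_zero (a := a) (b := b) (c := c + 2 * ε * a) (d := d + 2 * ε * b)
    (by linear_combination hdet) hτ
  have e1 : ((c + 2 * ε * a : ℤ) : ℂ) * τ + ((d + 2 * ε * b : ℤ) : ℂ)
      = (c * τ + d) * (2 * ε * ((a * τ + b) / (c * τ + d)) + 1) := by
    push_cast
    field_simp
    ring
  have h2 := right_ne_zero_of_mul (e1 ▸ h1)
  have e2 : (a * τ + b) / (((c + 2 * ε * a : ℤ) : ℂ) * τ + ((d + 2 * ε * b : ℤ) : ℂ))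
      = (a * τ + b) / (c * τ + d) / (2 * ε * ((a * τ + b) / (c * τ + d)) + 1) := by
    rw [e1, div_div]
  rw [e2, e1, mul_pow, mul_assoc, hB _ (im_moebius_pos hdet hτ), mul_add, hp τ hτ, mul_left_comm,
    hq τ h0, map_add]
  ring

theorem hasRationalPeriod_of_lower_left_eq_zero
    (hA : ∀ ε : ℤ, ∃ p : Polynomial ℚ, p.natDegree ≤ N ∧ ∀ τ : ℂ, 0 < τ.im →
      F (τ + 2 * ε) = F τ + κ * Polynomial.aeval τ p)
    {a b d : ℤ} (hdet : a * d = 1) (hb : Even b) : HasRationalPeriod F κ N a b 0 d := by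
  have hd : d * d = 1 ∧ a = d := by
    rcases Int.mul_eq_one_iff_eq_one_or_neg_one.mp hdet with ⟨rfl, rfl⟩ | ⟨rfl, rfl⟩ <;> simp
  have h0 : HasRationalPeriod F κ N a 0 0 d := by
    -- The sign enters here: minus the identity acts trivially on `τ` but by `(-1) ^ N` on the
    -- weight factor.
    refine ⟨d ^ N, ?_, 0, fun τ _ => ?_⟩
    · rcases Int.mul_eq_one_iff_eq_one_or_neg_one.mp hdet with ⟨-, rfl⟩ | ⟨-, rfl⟩
      · simp
      · exact neg_one_pow_eq_or ℤ N
    · have hd0 : (d : ℂ) ≠ 0 := by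
        intro h; rw [Int.cast_eq_zero.mp h] at hdet; simp at hdet
      rw [hd.2]
      simp only [Int.cast_zero, zero_mul, zero_add, add_zero, map_zero, mul_zero]
      rw [mul_div_cancel_left₀ _ hd0]
      push_cast
      ring
  obtain ⟨k, rfl⟩ := hb
  have h1 := h0.add_two_mul_left (hA (k * d)) (by simpa using hdet)
  have e : 0 + 2 * (k * d) * d = k + k := by linear_combination 2 * k * hd.1
  rwa [mul_zero, add_zero, e] at h1

theorem exists_natAbs_sub_lt {x y : ℤ} (hy : y ≠ 0) (hxy : y.natAbs < x.natAbs) :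
    ∃ ε : ℤ, (x - 2 * ε * y).natAbs < x.natAbs := by
  rcases le_total 0 x with hx | hx <;> rcases le_total 0 y with hy' | hy'
  · exact ⟨1, by omega⟩
  · exact ⟨-1, by omega⟩
  · exact ⟨-1, by omega⟩
  · exact ⟨1, by omega⟩

/-- Euclid's algorithm with even quotients on the first column: `a` is odd and `c` even, so their
absolute values never tie and the larger can be reduced until `c = 0`. -/
theorem hasRationalPeriod_of_even
    (hA : ∀ ε : ℤ, ∃ p : Polynomial ℚ, p.natDegree ≤ N ∧ ∀ τ : ℂ, 0 < τ.im →
      F (τ + 2 * ε) = F τ + κ * Polynomial.aeval τ p)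
    (hB : ∀ ε : ℤ, ∃ p : Polynomial ℚ, p.natDegree ≤ N ∧ ∀ τ : ℂ, 0 < τ.im →
      (2 * ε * τ + 1) ^ N * F (τ / (2 * ε * τ + 1)) = F τ + κ * Polynomial.aeval τ p)
    {a b c d : ℤ} (hdet : a * d - b * c = 1) (hb : Even b) (hc : Even c) :
    HasRationalPeriod F κ N a b c d := by
  induction hn : a.natAbs + c.natAbs using Nat.strong_induction_on generalizing a b c d with
  | _ n ih =>
    have ha : Odd a := by
      by_contra h
      rw [Int.not_odd_iff_even] at h
      have h1 : Even (a * d - b * c) := (h.mul_right d).sub (hb.mul_right c)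
      rw [hdet] at h1
      exact absurd h1 (by decide)
    rcases eq_or_ne c 0 with rfl | hc0
    · exact hasRationalPeriod_of_lower_left_eq_zero hA (by simpa using hdet) hb
    have ha0 : a ≠ 0 := by rintro rfl; exact absurd ha (by decide)
    have hne : a.natAbs ≠ c.natAbs := by
      obtain ⟨k, hk⟩ := ha
      obtain ⟨l, hl⟩ := hc
      omega
    rcases lt_or_gt_of_ne hne with hlt | hlt
    · obtain ⟨ε, hε⟩ := exists_natAbs_sub_lt ha0 hlt
      have h1 := ih (a.natAbs + (c - 2 * ε * a).natAbs) (by omega) (a := a) (b := b)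
        (c := c - 2 * ε * a) (d := d - 2 * ε * b) (by linear_combination hdet) hb
        (hc.sub ⟨ε * a, by ring⟩) rfl
      have h2 := h1.add_two_mul_right (hB ε) (by linear_combination hdet)
      simpa only [sub_add_cancel] using h2
    · obtain ⟨ε, hε⟩ := exists_natAbs_sub_lt hc0 hlt
      have h1 := ih ((a - 2 * ε * c).natAbs + c.natAbs) (by omega) (a := a - 2 * ε * c)
        (b := b - 2 * ε * d) (c := c) (d := d) (by linear_combination hdet)
        (hb.sub ⟨ε * d, by ring⟩) hc rfl
      have h2 := h1.add_two_mul_left (hA ε) (by linear_combination hdet)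
      simpa only [sub_add_cancel] using h2

end Generators

theorem complexSecantDirichlet_add_two_mul (s : ℕ) (τ : ℂ) (ε : ℤ) :
    complexSecantDirichlet s (τ + 2 * ε) = complexSecantDirichlet s τ := by
  refine tsum_congr fun n => ?_
  rw [complexSecantTerm, complexSecantTerm,
    show (Real.pi * (n + 1 : ℕ) * (τ + 2 * ε) : ℂ)
      = Real.pi * (n + 1 : ℕ) * τ + ((n + 1 : ℕ) * ε : ℤ) * (2 * Real.pi) by push_cast; ring,
    Complex.cos_add_int_mul_two_pi]

theorem cot_add_int_mul_pi (z : ℂ) (k : ℤ) :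
    Complex.cot (z + k * Real.pi) = Complex.cot z := by
  have h : Function.Periodic Complex.cot Real.pi := fun w => by
    rw [Complex.cot_eq_cos_div_sin, Complex.cot_eq_cos_div_sin, Complex.cos_add_pi,
      Complex.sin_add_pi, neg_div_neg_eq]
  exact h.int_mul k z

/-- The argument `oddC m / (2 * τ)` shifts by the integer `ε * (2 * m + 1)`, a period of the
cotangent. -/
theorem oddCotSum_div (s : ℕ) {τ : ℂ} (hτ : 0 < τ.im) (ε : ℤ) :
    oddCotSum s (τ / (2 * ε * τ + 1)) = oddCotSum s τ := by
  have hτ0 := ne_zero_of_im_ne_zero hτ.ne'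
  have h0 : (2 * ε * τ + 1 : ℂ) ≠ 0 := by
    simpa using moebius_denom_ne_zero (a := 1) (b := 0) (c := 2 * ε) (d := 1) (by ring) hτ
  refine tsum_congr fun m => ?_
  have e : Real.pi * (oddC m / (2 * (τ / (2 * ε * τ + 1))))
      = Real.pi * (oddC m / (2 * τ)) + ((ε * (2 * m + 1) : ℤ) : ℂ) * Real.pi := by
    rw [oddC]
    push_cast
    field_simp
    ring
  rw [e, cot_add_int_mul_pi]

/-- The correction `q * τ ^ (2 * L + 2)` costs translations only a polynomial of smaller degree, the
leading terms cancelling, and it removes the pole from the defect of the other generator. -/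
theorem exists_hasRationalPeriod (L : ℕ) : ∃ q : ℚ, ∀ a b c d : ℤ, a * d - b * c = 1 → Even b →
    Even c → HasRationalPeriod (fun τ => complexSecantDirichlet (2 * L + 2) τ
      + Real.pi ^ (2 * L + 2) * (q * τ ^ (2 * L + 2))) (Real.pi ^ (2 * L + 2)) (2 * L + 1)
      a b c d := by
  obtain ⟨e, q, h⟩ := exists_complexSecantDirichlet_eq L
  refine ⟨q, fun a b c d hdet hb hc => hasRationalPeriod_of_even ?_ ?_ hdet hb hc⟩
  · intro ε
    refine ⟨Polynomial.C q * ((Polynomial.X + Polynomial.C (2 * ε : ℚ)) ^ (2 * L + 2)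
      - Polynomial.X ^ (2 * L + 2)), ?_, fun τ _ => ?_⟩
    · refine (Polynomial.natDegree_C_mul_le _ _).trans (Nat.lt_succ_iff.mp ?_)
      have h1 := (Polynomial.monic_X_add_C (2 * ε : ℚ)).pow (2 * L + 2)
      have h2 : ((Polynomial.X + Polynomial.C (2 * ε : ℚ)) ^ (2 * L + 2)).natDegree
          = 2 * L + 2 := by
        rw [Polynomial.natDegree_pow, Polynomial.natDegree_X_add_C, mul_one]
      have h3 := Polynomial.degree_sub_lt_left
        (p := (Polynomial.X + Polynomial.C (2 * ε : ℚ)) ^ (2 * L + 2))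
        (q := Polynomial.X ^ (2 * L + 2))
        (by rw [Polynomial.degree_eq_natDegree h1.ne_zero, h2, Polynomial.degree_X_pow])
        h1.ne_zero (by rw [h1.leadingCoeff, (Polynomial.monic_X_pow _).leadingCoeff])
      rw [Polynomial.degree_eq_natDegree h1.ne_zero, h2] at h3
      rcases eq_or_ne ((Polynomial.X + Polynomial.C (2 * ε : ℚ)) ^ (2 * L + 2)
        - Polynomial.X ^ (2 * L + 2)) 0 with h0 | h0
      · rw [h0, Polynomial.natDegree_zero]
        omega
      · exact (Polynomial.natDegree_lt_iff_degree_lt h0).mpr h3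
    · rw [complexSecantDirichlet_add_two_mul]
      simp
      ring
  · intro ε
    refine ⟨∑ k ∈ range (L + 1), Polynomial.C (e k) * Polynomial.X ^ (2 * k) *
      ((Polynomial.C (2 * ε : ℚ) * Polynomial.X + 1) ^ (2 * L + 1 - 2 * k) - 1), ?_,
      fun τ hτ => ?_⟩
    · refine Polynomial.natDegree_sum_le_of_forall_le _ _ fun k hk => ?_
      have hk' := mem_range.mp hk
      have h1 : (Polynomial.C (2 * ε : ℚ) * Polynomial.X + 1).natDegree ≤ 1 :=
        Polynomial.natDegree_linear_le (a := (2 * ε : ℚ)) (b := 1)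
      have h2 := Polynomial.natDegree_pow_le_of_le (2 * L + 1 - 2 * k) h1
      have h3 := Polynomial.natDegree_sub_le_of_le h2 (Polynomial.natDegree_one (R := ℚ)).le
      refine (Polynomial.natDegree_mul_le_of_le (Polynomial.natDegree_C_mul_X_pow_le _ _) h3).trans ?_
      omega
    · have h0 : (2 * ε * τ + 1 : ℂ) ≠ 0 := by
        simpa using moebius_denom_ne_zero (a := 1) (b := 0) (c := 2 * ε) (d := 1) (by ring) hτ
      have him : 0 < (τ / (2 * ε * τ + 1)).im := by
        simpa using im_moebius_pos (a := 1) (b := 0) (c := 2 * ε) (d := 1) (by ring) hτ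
      rw [h _ him, h _ hτ, oddCotSum_div _ hτ, map_sum, mul_add, mul_left_comm, mul_sum,
        add_right_comm, ← mul_add, ← sum_add_distrib, div_pow]
      congr 1
      · congr 1
        refine sum_congr rfl fun k hk => ?_
        obtain ⟨l, rfl⟩ : ∃ l, L = k + l := ⟨L - k, by have := mem_range.mp hk; omega⟩
        rw [show 2 * (k + l) + 1 = 2 * k + (2 * l + 1) by ring, Nat.add_sub_cancel_left]
        simp
        rw [div_pow, pow_add]
        field_simp
        ring
      · field_simp

/-! ### The fixed point and the triangular system -/

/-- A hyperbolic element of the principal congruence subgroup of level 2 fixing a given real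
quadratic irrationality. -/
theorem IsRealQuadraticIrrationality.exists_moebius_fixing {ρ : ℝ}
    (hρ : IsRealQuadraticIrrationality ρ) :
    ∃ a b c d : ℤ, a * d - b * c = 1 ∧ Even b ∧ Even c ∧ c ≠ 0 ∧
      (a : ℝ) * ρ + b = ρ * (c * ρ + d) := by
  obtain ⟨hirr, A, B, C, hA, h⟩ := hρ
  have hsq : (2 * A * ρ + B) ^ 2 = ((B ^ 2 - 4 * A * C : ℤ) : ℝ) := by
    push_cast
    linear_combination 4 * A * h
  have hirr2 : Irrational (2 * A * ρ + B) := by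
    have := (hirr.intCast_mul (m := 2 * A) (by simpa using hA)).add_intCast B
    simpa using this
  have hD0 : 0 < B ^ 2 - 4 * A * C := by
    have : (0 : ℝ) < ((B ^ 2 - 4 * A * C : ℤ) : ℝ) := by
      rw [← hsq]
      have := hirr2.ne_zero
      positivity
    exact_mod_cast this
  have hDsq : ¬ IsSquare (B ^ 2 - 4 * A * C) := by
    rintro ⟨k, hk⟩
    rw [hk] at hsq
    have h1 : (2 * A * ρ + B) ^ 2 = (k : ℝ) ^ 2 := by rw [hsq]; push_cast; ring
    rcases sq_eq_sq_iff_eq_or_eq_neg.mp h1 with h2 | h2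
    · exact hirr2 ⟨k, by rw [h2]; simp⟩
    · exact hirr2 ⟨-k, by rw [h2]; simp⟩
  -- The matrix is that of the Pell unit `t + u * √D`, with `D` the discriminant; not halving `t`
  -- and `u` makes the off-diagonal entries even.
  obtain ⟨t, u, htu, hu⟩ := Pell.exists_of_not_isSquare hD0 hDsq
  refine ⟨t - B * u, -(2 * C * u), 2 * A * u, t + B * u, by linear_combination htu,
    ⟨-(C * u), by ring⟩, ⟨A * u, by ring⟩, by simp [hA, hu], ?_⟩
  push_cast
  linear_combination (-2 * u : ℝ) * h

theorem coeff_eq_zero_of_isLittleO {ι : Type*} {l : Filter ι} [l.NeBot] {t : ι → ℂ}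
    (ht : Tendsto t l (𝓝 0)) (ht0 : ∀ᶠ y in l, t y ≠ 0) {P : Polynomial ℂ} {j : ℕ}
    (h : (fun y => P.eval (t y)) =o[l] fun y => t y ^ j) {i : ℕ} (hi : i ≤ j) :
    P.coeff i = 0 := by
  induction i using Nat.strong_induction_on with
  | _ i ih =>
    obtain ⟨R, rfl⟩ : Polynomial.X ^ i ∣ P :=
      Polynomial.X_pow_dvd_iff.mpr fun m hm => ih m hm (by omega)
    have h1 : (fun y => t y ^ j) =O[l] fun y => t y ^ i := by
      obtain ⟨k, rfl⟩ := Nat.exists_eq_add_of_le hi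
      have h2 : (fun y => t y ^ k) =O[l] fun _ => (1 : ℂ) := (ht.pow k).isBigO_one ℂ
      simpa [pow_add] using (isBigO_refl (fun y => t y ^ i) l).mul h2
    have h2 := (h.trans_isBigO h1).tendsto_div_nhds_zero
    have h3 : Tendsto (fun y => R.eval (t y)) l (𝓝 0) := by
      refine h2.congr' ?_
      filter_upwards [ht0] with y hy
      rw [Polynomial.eval_mul, Polynomial.eval_pow, Polynomial.eval_X,
        mul_div_cancel_left₀ _ (pow_ne_zero i hy)]
    have h4 := tendsto_nhds_unique h3 ((R.continuous.tendsto 0).comp ht)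
    rw [Polynomial.coeff_X_pow_mul', if_pos le_rfl, Nat.sub_self, Polynomial.coeff_zero_eq_eval_zero]
    exact h4.symm

section Triangular

variable {K : Type*} [Field K]

/-- The triangular system over `K` solved by the Taylor coefficients. -/
theorem exists_solution_of_triangular {G : ℕ → Polynomial K} {P : Polynomial K} {j : ℕ} (κ : ℝ)
    (hlow : ∀ k i, i < k → (G k).coeff i = 0) (hdiag : ∀ k ≤ j, (G k).coeff k ≠ 0) :
    ∀ i ≤ j, ∃ x : K, ∀ (φ : K →+* ℝ) (b : ℕ → ℝ),
      (∀ i ≤ j, ∑ k ∈ range (j + 1), b k * φ ((G k).coeff i) = κ * φ (P.coeff i)) →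
      b i = κ * φ x := by
  intro i
  induction i using Nat.strong_induction_on with
  | _ i ih =>
    intro hi
    have ih' (k : ℕ) : ∃ x : K, k < i → ∀ (φ : K →+* ℝ) (b : ℕ → ℝ),
      (∀ i ≤ j, ∑ k ∈ range (j + 1), b k * φ ((G k).coeff i) = κ * φ (P.coeff i)) →
      b k = κ * φ x := by
      by_cases hk : k < i
      · obtain ⟨x, hx⟩ := ih k hk (by omega)
        exact ⟨x, fun _ => hx⟩
      · exact ⟨0, fun h => absurd h hk⟩
    choose x hx using ih'
    refine ⟨(P.coeff i - ∑ k ∈ range i, x k * (G k).coeff i) / (G i).coeff i, fun φ b hb => ?_⟩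
    have h1 := hb i hi
    have h2 : ∑ k ∈ range (j + 1), b k * φ ((G k).coeff i)
        = ∑ k ∈ range (i + 1), b k * φ ((G k).coeff i) := by
      symm
      refine sum_subset (range_subset_range.mpr (by omega)) fun k _ hk => ?_
      rw [hlow k i (by simpa using hk), map_zero, mul_zero]
    have h3 : ∑ k ∈ range i, b k * φ ((G k).coeff i)
        = κ * φ (∑ k ∈ range i, x k * (G k).coeff i) := by
      rw [map_sum, mul_sum]
      refine sum_congr rfl fun k hk => ?_
      rw [hx k (mem_range.mp hk) φ b hb, map_mul, mul_assoc]
    rw [h2, sum_range_succ, h3] at h1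
    have h4 : φ ((G i).coeff i) ≠ 0 := (map_ne_zero φ).mpr (hdiag i hi)
    rw [map_div₀, map_sub]
    field_simp
    linear_combination h1

/-- The matrix of the triangular system. -/
noncomputable def jetPolynomial (ε c σ : K) (s k : ℕ) : Polynomial K :=
  Polynomial.X ^ k * (Polynomial.C (ε⁻¹ ^ k) *
    (Polynomial.C ε + Polynomial.C c * Polynomial.X) ^ (s - k)
    - Polynomial.C σ * (Polynomial.C ε + Polynomial.C c * Polynomial.X))

theorem coeff_jetPolynomial_of_lt (ε c σ : K) (s : ℕ) {k i : ℕ} (h : i < k) :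
    (jetPolynomial ε c σ s k).coeff i = 0 := by
  rw [jetPolynomial, Polynomial.coeff_X_pow_mul', if_neg (by omega)]

theorem coeff_jetPolynomial_self (ε c σ : K) (s k : ℕ) :
    (jetPolynomial ε c σ s k).coeff k = ε⁻¹ ^ k * ε ^ (s - k) - σ * ε := by
  rw [jetPolynomial, Polynomial.coeff_X_pow_mul', if_pos le_rfl, Nat.sub_self,
    Polynomial.coeff_zero_eq_eval_zero]
  simp

end Triangular

/-! ### Comparing expansions at the fixed point -/

/-- Comparison of the Taylor expansions of both sides of the functional equation at a fixed
point. -/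
theorem IsRealQuadraticIrrationality.sum_mul_coeff_eq {K : Type*} [Field K] [Algebra ℚ K]
    (φ : K →+* ℝ) (θ : K) (hρ : IsRealQuadraticIrrationality (φ θ)) {s j : ℕ} (hjs : 2 * j + 2 ≤ s)
    {a b c d σ : ℤ} (hdet : a * d - b * c = 1) (hfix : (a : K) * θ + b = θ * (c * θ + d))
    {p : Polynomial ℚ} (hp : ∀ τ : ℂ, 0 < τ.im →
      (c * τ + d) ^ s * complexSecantDirichlet s ((a * τ + b) / (c * τ + d))
        = σ * (c * τ + d) * complexSecantDirichlet s τ + Real.pi ^ s * Polynomial.aeval τ p)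
    {i : ℕ} (hi : i ≤ j) :
    ∑ k ∈ range (j + 1), secantDirichletD k s (φ θ) / k.factorial *
        φ ((jetPolynomial (c * θ + d) (c : K) (σ : K) s k).coeff i)
      = Real.pi ^ s * φ (((p.map (algebraMap ℚ K)).comp
          (Polynomial.X + Polynomial.C θ)).coeff i) := by
  set ρ := φ θ with hρdef
  set ε : ℝ := c * ρ + d with hε
  have hε0 : ε ≠ 0 := by
    intro h0
    have h1 : (a : ℝ) * ρ + b = 0 := by
      have := congrArg φ hfix
      simp only [map_add, map_mul, map_intCast] at this
      rw [this, ← hρdef, ← hε, h0, mul_zero]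
    have h2 : (c * ρ + d) * a - (a * ρ + b) * c = (1 : ℝ) := by
      have : (a * d - b * c : ℝ) = 1 := by exact_mod_cast hdet
      linear_combination this
    rw [h1, ← hε, h0] at h2
    simp at h2
  have hfixR : (a : ℝ) * ρ + b = ρ * ε := by
    have := congrArg φ hfix
    simpa only [map_add, map_mul, map_intCast] using this
  let ψ : K →+* ℂ := Complex.ofRealHom.comp φ
  let B : ℕ → ℂ := fun k => ((secantDirichletD k s ρ / k.factorial : ℝ) : ℂ)
  let Q : Polynomial ℂ := ∑ k ∈ range (j + 1), Polynomial.C (B k) *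
      (jetPolynomial (c * θ + d) (c : K) (σ : K) s k).map ψ
    - Polynomial.C (Real.pi ^ s : ℂ) *
      ((p.map (algebraMap ℚ K)).comp (Polynomial.X + Polynomial.C θ)).map ψ
  suffices hQ : Q.coeff i = 0 by
    simp only [Q, Polynomial.coeff_sub, Polynomial.finsetSum_coeff, Polynomial.coeff_C_mul,
      Polynomial.coeff_map, sub_eq_zero] at hQ
    have : ((∑ k ∈ range (j + 1), secantDirichletD k s ρ / k.factorial *
        φ ((jetPolynomial (c * θ + d) (c : K) (σ : K) s k).coeff i) : ℝ) : ℂ)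
        = ((Real.pi ^ s * φ (((p.map (algebraMap ℚ K)).comp
          (Polynomial.X + Polynomial.C θ)).coeff i) : ℝ) : ℂ) := by
      push_cast
      simpa [B, ψ] using hQ
    exact_mod_cast this
  let t : ℝ → ℂ := fun y => y * Complex.I
  have ht : Tendsto t (𝓝[>] 0) (𝓝 0) := by
    have : Continuous t := by fun_prop
    have h := (this.tendsto 0).mono_left (nhdsWithin_le_nhds (s := Set.Ioi 0))
    simpa [t] using h
  have hpos : ∀ᶠ y : ℝ in 𝓝[>] 0, 0 < y := self_mem_nhdsWithin
  have ht0 : ∀ᶠ y in 𝓝[>] 0, t y ≠ 0 := by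
    filter_upwards [hpos] with y hy
    simp [t, hy.ne']
  refine coeff_eq_zero_of_isLittleO ht ht0 ?_ hi
  have hT := hρ.tendsto_complexSecantDirichlet_sub hjs
  let D : ℝ → ℂ := fun y => ε + c * t y
  -- The displacement of the image: the transformation sends `ρ + t` to `ρ + v`.
  let v : ℝ → ℂ := fun y => t y / (ε * D y)
  have hD : Tendsto D (𝓝[>] 0) (𝓝 ε) := by
    have := (ht.const_mul (c : ℂ)).const_add (ε : ℂ)
    simpa using this
  have hεC : (ε : ℂ) ≠ 0 := by exact_mod_cast hε0
  have hD0 : ∀ᶠ y in 𝓝[>] 0, D y ≠ 0 := hD.eventually_ne hεC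
  have hv : Tendsto v (𝓝[>] 0) (𝓝 0) := by
    have := ht.div (hD.const_mul (ε : ℂ)) (mul_ne_zero hεC hεC)
    rw [zero_div] at this
    exact this
  have hvt : v =O[𝓝[>] 0] t := by
    have h1 : (fun y => (ε * D y)⁻¹) =O[𝓝[>] 0] fun _ => (1 : ℂ) :=
      ((hD.const_mul (ε : ℂ)).inv₀ (mul_ne_zero hεC hεC)).isBigO_one ℂ
    simpa [v, div_eq_mul_inv] using (isBigO_refl t (𝓝[>] 0)).mul h1
  have hnormD : ∀ᶠ y in 𝓝[>] 0, ‖D y‖ < 2 * |ε| := by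
    refine hD.norm.eventually_lt_const ?_
    rw [Complex.norm_real, Real.norm_eq_abs]
    linarith [abs_pos.mpr hε0]
  have hden (y : ℝ) : (c : ℂ) * (ρ + t y) + d = D y := by
    simp only [D, hε]; push_cast; ring
  have hnum (y : ℝ) (hy : D y ≠ 0) :
      ((a : ℂ) * (ρ + t y) + b) / (c * (ρ + t y) + d) = ρ + v y := by
    have h1 : (a : ℂ) * ρ + b = ρ * ε := by exact_mod_cast hfixR
    have h2 : (a * d - b * c : ℂ) = 1 := by exact_mod_cast hdet
    have h3 : (ε : ℂ) = c * ρ + d := by rw [hε]; push_cast; ring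
    have h4 : (a : ℂ) * ε - c * ρ * ε = 1 := by
      rw [mul_assoc, ← h1, h3]; linear_combination h2
    rw [hden]
    simp only [v]
    field_simp
    simp only [D]
    linear_combination (ε : ℂ) * h1 + t y * h4
  have hcone1 : Tendsto (fun y => (ρ : ℂ) + t y) (𝓝[>] 0)
      (𝓝[{w : ℂ | 0 < w.im ∧ ‖w - ρ‖ ≤ 2 * w.im}] (ρ : ℂ)) := by
    refine tendsto_nhdsWithin_iff.mpr ⟨by simpa using ht.const_add (ρ : ℂ), ?_⟩
    filter_upwards [hpos] with y hy
    simp [t, hy, abs_of_pos hy]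
  -- The image of the vertical approach stays in the cone: `‖v‖ / Im v = ‖D‖ / |ε|` tends to 1,
  -- below the aperture 2.
  have hcone2 : Tendsto (fun y => (ρ : ℂ) + v y) (𝓝[>] 0)
      (𝓝[{w : ℂ | 0 < w.im ∧ ‖w - ρ‖ ≤ 2 * w.im}] (ρ : ℂ)) := by
    refine tendsto_nhdsWithin_iff.mpr ⟨by simpa using hv.const_add (ρ : ℂ), ?_⟩
    filter_upwards [hpos, hD0, hnormD] with y hy hy0 hyn
    have him : ((ρ : ℂ) + v y).im = y / ‖D y‖ ^ 2 := by
      rw [← hnum y hy0, im_moebius hdet, hden, Complex.normSq_eq_norm_sq]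
      simp [t]
    have hDp : 0 < ‖D y‖ := norm_pos_iff.mpr hy0
    have hεp : 0 < |ε| := abs_pos.mpr hε0
    refine ⟨by rw [him]; positivity, ?_⟩
    rw [him, add_sub_cancel_left]
    have : ‖v y‖ = y / (|ε| * ‖D y‖) := by
      simp [v, t, abs_of_pos hy]
    rw [this, mul_div_assoc', div_le_div_iff₀ (by positivity) (by positivity)]
    nlinarith [mul_pos hy hDp]
  have ho1 : (fun y => complexSecantDirichlet s (ρ + t y) - ∑ k ∈ range (j + 1), B k * t y ^ k)
      =o[𝓝[>] 0] fun y => t y ^ j := by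
    refine isLittleO_of_tendsto' ?_ ?_
    · filter_upwards [ht0] with y hy h0
      exact absurd h0 (pow_ne_zero j hy)
    · simpa only [Function.comp_def, add_sub_cancel_left] using hT.comp hcone1
  have ho2 : (fun y => complexSecantDirichlet s (ρ + v y) - ∑ k ∈ range (j + 1), B k * v y ^ k)
      =o[𝓝[>] 0] fun y => t y ^ j := by
    refine IsLittleO.trans_isBigO (g := fun y => v y ^ j) (isLittleO_of_tendsto' ?_ ?_)
      (hvt.pow j)
    · filter_upwards [ht0, hD0] with y hy hy0 h0
      exact absurd h0 (pow_ne_zero j (div_ne_zero hy (mul_ne_zero hεC hy0)))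
    · simpa only [Function.comp_def, add_sub_cancel_left] using hT.comp hcone2
  have hb1 : (fun y => (σ : ℂ) * D y) =O[𝓝[>] 0] fun _ => (1 : ℂ) :=
    (hD.const_mul (σ : ℂ)).isBigO_one ℂ
  have hb2 : (fun y => D y ^ s) =O[𝓝[>] 0] fun _ => (1 : ℂ) := (hD.pow s).isBigO_one ℂ
  have ho := (hb1.mul_isLittleO ho1).sub (hb2.mul_isLittleO ho2)
  simp only [one_mul] at ho
  refine ho.congr' ?_ (Eventually.of_forall fun y => rfl)
  filter_upwards [hpos, hD0] with y hy hy0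
  have hfe := hp (ρ + t y) (by simpa [t] using hy)
  rw [hnum y hy0, hden] at hfe
  have hev1 (k : ℕ) (hk : k ∈ range (j + 1)) :
      ((jetPolynomial (c * θ + d) (c : K) (σ : K) s k).map ψ).eval (t y)
      = D y ^ s * v y ^ k - σ * D y * t y ^ k := by
    obtain ⟨l, rfl⟩ : ∃ l, s = k + l := ⟨s - k, by have := mem_range.mp hk; omega⟩
    have e : ψ (c * θ + d) = (ε : ℂ) := by
      simp [ψ, hε, hρdef]
    have e1 : ψ c = (c : ℂ) := by simp
    have e2 : ψ σ = (σ : ℂ) := by simp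
    rw [jetPolynomial, Nat.add_sub_cancel_left]
    simp only [Polynomial.map_mul, Polynomial.map_sub, Polynomial.map_pow, Polynomial.map_X,
      Polynomial.map_C, Polynomial.map_add, Polynomial.eval_mul, Polynomial.eval_sub,
      Polynomial.eval_pow, Polynomial.eval_X, Polynomial.eval_C, Polynomial.eval_add, map_pow,
      map_inv₀, e, e1, e2]
    change t y ^ k * ((ε : ℂ)⁻¹ ^ k * D y ^ l - σ * D y) = _
    simp only [v]
    rw [div_pow, mul_pow (ε : ℂ), pow_add, inv_pow]
    field_simp
  have hev2 : (((p.map (algebraMap ℚ K)).comp (Polynomial.X + Polynomial.C θ)).map ψ).eval (t y)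
      = Polynomial.aeval (ρ + t y) p := by
    rw [Polynomial.map_comp, Polynomial.eval_comp, Polynomial.map_map, Polynomial.map_add,
      Polynomial.map_X, Polynomial.map_C, Polynomial.eval_add, Polynomial.eval_X,
      Polynomial.eval_C, Polynomial.aeval_def, Polynomial.eval_map,
      Subsingleton.elim (ψ.comp (algebraMap ℚ K)) (algebraMap ℚ ℂ), add_comm]
    rfl
  have hQe : Q.eval (t y) = D y ^ s * ∑ k ∈ range (j + 1), B k * v y ^ k
      - σ * D y * ∑ k ∈ range (j + 1), B k * t y ^ k
      - Real.pi ^ s * Polynomial.aeval (ρ + t y) p := by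
    simp only [Q, Polynomial.eval_sub, Polynomial.eval_finsetSum, Polynomial.eval_mul,
      Polynomial.eval_C, hev2]
    rw [sum_congr rfl fun k hk => by rw [hev1 k hk], mul_sum, mul_sum, ← sum_sub_distrib]
    congr 1
    exact sum_congr rfl fun k _ => by ring
  rw [hQe]
  linear_combination -hfe

/-- One extra factor `c * τ + d` clears the denominator left by the correction term, so the
uncorrected series also has a polynomial defect. -/
theorem exists_functional_equation (L : ℕ) {a b c d : ℤ} (hdet : a * d - b * c = 1)
    (hb : Even b) (hc : Even c) :
    ∃ σ : ℤ, (σ = 1 ∨ σ = -1) ∧ ∃ p : Polynomial ℚ, ∀ τ : ℂ, 0 < τ.im →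
      (c * τ + d) ^ (2 * L + 2) *
          complexSecantDirichlet (2 * L + 2) ((a * τ + b) / (c * τ + d))
        = σ * (c * τ + d) * complexSecantDirichlet (2 * L + 2) τ
          + Real.pi ^ (2 * L + 2) * Polynomial.aeval τ p := by
  obtain ⟨q, hq⟩ := exists_hasRationalPeriod L
  obtain ⟨σ, hσ, p, hp⟩ := hq a b c d hdet hb hc
  refine ⟨σ, hσ, (Polynomial.C (c : ℚ) * Polynomial.X + Polynomial.C (d : ℚ)) *
    (Polynomial.C (σ * q) * Polynomial.X ^ (2 * L + 2) + p) -
    Polynomial.C q * (Polynomial.C (a : ℚ) * Polynomial.X + Polynomial.C (b : ℚ)) ^ (2 * L + 2),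
    fun τ hτ => ?_⟩
  have h0 := moebius_denom_ne_zero hdet hτ
  have h := hp τ hτ
  beta_reduce at h
  rw [div_pow] at h
  have h1 : (c * τ + d : ℂ) ^ (2 * L + 2) * ((a * τ + b) ^ (2 * L + 2) / (c * τ + d) ^ (2 * L + 2))
      = (a * τ + b) ^ (2 * L + 2) := mul_div_cancel₀ _ (pow_ne_zero _ h0)
  simp only [map_sub, map_mul, map_add, map_pow, Polynomial.aeval_C, Polynomial.aeval_X,
    eq_ratCast, Rat.cast_intCast]
  linear_combination (c * τ + d) * h - Real.pi ^ (2 * L + 2) * q * h1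

/-! ### Values in the quadratic field and conjugation -/

/-- The matrix and its defect polynomial are rational, so the same system over `K` governs every
real embedding; hence `x` precedes `φ`. -/
theorem exists_secantDirichletD_eq {K : Type*} [Field K] [Algebra ℚ K] (φ₀ : K →+* ℝ) (θ : K)
    (hρ : IsRealQuadraticIrrationality (φ₀ θ)) {s j : ℕ} (hjs : 2 * j + 2 ≤ s) (hs : Even s) :
    ∃ x : K, ∀ φ : K →+* ℝ, secantDirichletD j s (φ θ) = Real.pi ^ s * φ x := by
  obtain ⟨a, b, c, d, hdet, hb, hc, hc0, hfix⟩ := hρ.exists_moebius_fixing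
  obtain ⟨L, rfl⟩ : ∃ L, s = 2 * L + 2 := by
    obtain ⟨k, rfl⟩ := hs
    exact ⟨k - 1, by omega⟩
  have hfixK : (a : K) * θ + b = θ * (c * θ + d) := φ₀.injective (by simpa using hfix)
  obtain ⟨σ, hσ, p, hp⟩ := exists_functional_equation L hdet hb hc
  have hirr : Irrational (c * φ₀ θ + d) := by
    have := (hρ.1.intCast_mul hc0).add_intCast d
    simpa using this
  have hε0 : (c * θ + d : K) ≠ 0 := by
    intro h
    have := congrArg φ₀ h
    simp only [map_add, map_mul, map_intCast, map_zero] at this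
    exact hirr.ne_zero this
  have hdiag : ∀ k ≤ j, (jetPolynomial (c * θ + d) (c : K) (σ : K) (2 * L + 2) k).coeff k ≠ 0 := by
    intro k hk h
    rw [coeff_jetPolynomial_self, sub_eq_zero] at h
    obtain ⟨l, hl⟩ : ∃ l, L = k + l := ⟨L - k, by omega⟩
    rw [show 2 * L + 2 - k = k + (2 * l + 1) + 1 by omega, pow_succ, pow_add, inv_pow,
      ← mul_assoc, inv_mul_cancel_left₀ (pow_ne_zero k hε0)] at h
    have h1 := congrArg φ₀ (mul_right_cancel₀ hε0 h)
    simp only [map_add, map_mul, map_intCast, map_pow] at h1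
    -- The exponent `2 * L + 1 - 2 * k` is positive since `s ≥ 2 * j + 2`, so a vanishing diagonal
    -- entry would force the irrational `c * ρ + d` to be `±1`.
    have h2 : |(c * φ₀ θ + d : ℝ)| ^ (2 * l + 1) = 1 := by
      rw [← abs_pow, h1]
      rcases hσ with rfl | rfl <;> simp
    rw [pow_eq_one_iff_of_nonneg (abs_nonneg _) (by omega)] at h2
    rcases eq_or_eq_neg_of_abs_eq h2 with h3 | h3
    · exact hirr ⟨1, by rw [h3]; simp⟩
    · exact hirr ⟨-1, by rw [h3]; simp⟩
  obtain ⟨x, hx⟩ := exists_solution_of_triangular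
    (G := jetPolynomial (c * θ + d) (c : K) (σ : K) (2 * L + 2))
    (P := (p.map (algebraMap ℚ K)).comp (Polynomial.X + Polynomial.C θ)) (Real.pi ^ (2 * L + 2))
    (fun k i h => coeff_jetPolynomial_of_lt _ _ _ _ h) hdiag j le_rfl
  refine ⟨j.factorial * x, fun φ => ?_⟩
  have hρφ : IsRealQuadraticIrrationality (φ θ) := by
    obtain ⟨hirr0, A, B, C, hA, h⟩ := hρ
    refine ⟨?_, A, B, C, hA, ?_⟩
    · rintro ⟨q, hq⟩
      have : θ = (q : K) := φ.injective (by simpa using hq.symm)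
      exact hirr0 ⟨q, by rw [this]; simp⟩
    · have : (A * θ ^ 2 + B * θ + C : K) = 0 := φ₀.injective (by simpa using h)
      simpa using congrArg φ this
  have h1 := hx φ (fun k => secantDirichletD k (2 * L + 2) (φ θ) / k.factorial) fun i hi =>
    hρφ.sum_mul_coeff_eq φ θ hjs hdet hfixK hp hi
  have hj : (j.factorial : ℝ) ≠ 0 := by positivity
  rw [div_eq_iff hj] at h1
  rw [h1, map_mul, map_natCast]
  ring

theorem secantDirichletD_neg (j s : ℕ) (x : ℝ) :
    secantDirichletD j s (-x) = (-1) ^ j * secantDirichletD j s x := by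
  rw [secantDirichletD, secantDirichletD, ← tsum_mul_left]
  refine tsum_congr fun n => ?_
  have h : (fun y => secantTerm s (n + 1) (-y)) = secantTerm s (n + 1) := by
    ext y
    rw [secantTerm, secantTerm, mul_neg, Real.cos_neg]
  have h1 := iteratedDeriv_comp_neg j (secantTerm s (n + 1)) (-x)
  rw [h, neg_neg, smul_eq_mul] at h1
  exact h1

theorem Irrational.exists_conj_of_sq_eq {ρ : ℝ} (hirr : Irrational ρ) {r : ℚ}
    (hr : ρ ^ 2 = r) :
    ∃ φ : IntermediateField.adjoin ℚ ({ρ} : Set ℝ) →+* ℝ,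
      φ (IntermediateField.AdjoinSimple.gen ℚ ρ) = -ρ ∧
      ∀ x, φ x = x → ∃ u : ℚ, (x : ℝ) = u := by
  have hmonic : (Polynomial.X ^ 2 - Polynomial.C r : Polynomial ℚ).Monic :=
    Polynomial.monic_X_pow_sub_C r two_ne_zero
  have hint : IsIntegral ℚ ρ := ⟨Polynomial.X ^ 2 - Polynomial.C r, hmonic, by simp [hr]⟩
  have hmin : minpoly ℚ ρ = Polynomial.X ^ 2 - Polynomial.C r := by
    refine (minpoly.eq_of_irreducible_of_monic ?_ (by simp [hr]) hmonic).symm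
    rw [X_pow_sub_C_irreducible_iff_of_prime Nat.prime_two]
    intro q hq
    have h1 : ρ ^ 2 = (q : ℝ) ^ 2 := by rw [hr, ← hq]; push_cast; rfl
    rcases sq_eq_sq_iff_eq_or_eq_neg.mp h1 with h2 | h2
    · exact hirr ⟨q, h2.symm⟩
    · exact hirr ⟨-q, by rw [h2]; simp⟩
  let φ := (IntermediateField.algHomAdjoinIntegralEquiv ℚ (K := ℝ) hint).symm
    ⟨-ρ, by rw [Polynomial.mem_aroots, hmin]; exact ⟨hmonic.ne_zero, by simp [hr]⟩⟩
  have hφ : φ (IntermediateField.AdjoinSimple.gen ℚ ρ) = -ρ :=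
    IntermediateField.algHomAdjoinIntegralEquiv_symm_apply_gen ℚ hint _
  refine ⟨φ, hφ, fun x hx => ?_⟩
  have hspan : ∃ u v : ℚ, (x : ℝ) = u + v * ρ := by
    have hmem : (x : ℝ) ∈ Algebra.adjoin ℚ ({ρ} : Set ℝ) := by
      rw [← IntermediateField.adjoin_simple_toSubalgebra_of_isAlgebraic hint.isAlgebraic]
      exact x.2
    generalize (x : ℝ) = z at hmem
    induction hmem using Algebra.adjoin_induction with
    | mem y hy => exact ⟨0, 1, by rw [Set.mem_singleton_iff.mp hy]; simp⟩
    | algebraMap q => exact ⟨q, 0, by simp⟩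
    | add y z _ _ hy hz =>
      obtain ⟨u, v, rfl⟩ := hy
      obtain ⟨u', v', rfl⟩ := hz
      exact ⟨u + u', v + v', by push_cast; ring⟩
    | mul y z _ _ hy hz =>
      obtain ⟨u, v, rfl⟩ := hy
      obtain ⟨u', v', rfl⟩ := hz
      exact ⟨u * u' + v * v' * r, u * v' + v * u', by
        push_cast; linear_combination (v * v' : ℝ) * hr⟩
  obtain ⟨u, v, huv⟩ := hspan
  have hx' : x = (u : IntermediateField.adjoin ℚ ({ρ} : Set ℝ))
      + v * IntermediateField.AdjoinSimple.gen ℚ ρ := Subtype.ext (by simpa using huv)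
  have h1 : φ x = u - v * ρ := by
    rw [hx', map_add, map_mul, hφ, map_ratCast, map_ratCast]
    ring
  have h2 : (φ : _ →+* ℝ) x = φ x := rfl
  rw [h2, h1, huv] at hx
  have h3 : (v : ℝ) * ρ = 0 := by linarith
  exact ⟨u, by rw [huv, h3, add_zero]⟩

theorem mainTheorem3 (ρ : ℝ) (hρ : IsRealQuadraticIrrationality ρ) (j s : ℕ)
    (hjs : 2 * j + 2 ≤ s) (hs : Even s) :
    Summable (fun n : ℕ => secantTermD j s (n + 1) ρ) ∧
    (∃ x : ℝ, x ∈ IntermediateField.adjoin ℚ ({ρ} : Set ℝ) ∧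
      secantDirichletD j s ρ = Real.pi ^ s * x) ∧
    ((∃ r : ℚ, ρ ^ 2 = (r : ℝ)) → Even j →
      ∃ q : ℚ, secantDirichletD j s ρ = (Real.pi * ρ) ^ s * (q : ℝ)) := by
  let K := IntermediateField.adjoin ℚ ({ρ} : Set ℝ)
  let φ₀ : K →+* ℝ := algebraMap K ℝ
  have hθ : φ₀ (IntermediateField.AdjoinSimple.gen ℚ ρ) = ρ :=
    IntermediateField.AdjoinSimple.algebraMap_gen ℚ ρ
  obtain ⟨x, hx⟩ := exists_secantDirichletD_eq φ₀ (IntermediateField.AdjoinSimple.gen ℚ ρ)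
    (by rwa [hθ]) hjs hs
  have hx0 := hx φ₀
  rw [hθ] at hx0
  refine ⟨hρ.summable_secantTermD hjs, ⟨x, x.2, hx0⟩, ?_⟩
  rintro ⟨r, hr⟩ hj
  obtain ⟨φ, hφ, hfixed⟩ := hρ.1.exists_conj_of_sq_eq hr
  have hx1 := hx φ
  -- Evenness equates the values at `ρ` and at its conjugate `-ρ`, so `x` is fixed by conjugation
  -- and therefore rational.
  rw [hφ, secantDirichletD_neg, hj.neg_one_pow, one_mul, hx0] at hx1
  obtain ⟨u, hu⟩ := hfixed x (mul_left_cancel₀ (pow_ne_zero s Real.pi_ne_zero) hx1).symm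
  obtain ⟨k, rfl⟩ := hs
  have hr0 : (r : ℝ) ≠ 0 := hr ▸ pow_ne_zero 2 hρ.1.ne_zero
  refine ⟨u / r ^ k, ?_⟩
  have hx2 : secantDirichletD j (k + k) ρ = Real.pi ^ (k + k) * u := by
    rw [hx0, ← hu]; rfl
  rw [hx2, mul_pow, show ρ ^ (k + k) = (r : ℝ) ^ k by rw [← two_mul, pow_mul, hr]]
  push_cast
  field_simp
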